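/- For integers $n, d \ge 1$ let $A = P^{(1)} + \dots + P^{(d)}$, where $P^{(1)}, \dots, P^{(d)}$ are independent uniformly distributed random $n \times n$ permutation matrices. (1) Fix an integer $d \ge 1$ and let $(\Lambda_\ell)_{\ell \ge 1}$ be independent random variables with $\Lambda_\ell \sim \mathrm{Poisson}(d^\ell/\ell)$. Then for every integer $k \ge 1$, as $n \to \infty$, the random vector $$\big(\mathrm{tr}(A^j)\big)_{1 \le j \le k} \quad\text{converges in law to}\quad \Big(\sum_{\ell \mid j} \ell \Lambda_\ell\Big)_{1 \le j \le k},$$ where the sum runs over the positive divisors $\ell$ of $j$. (2) Let $d = d(n)$ be a sequence of positive integers such that $d(n) \to \infty$ and $d(n) = n^{o(1)}$ (that is, $\log d(n) = o(\log n)$) as $n \to \infty$, and let $(N_j)_{j \ge 1}$ be independent standard real Gaussian random variables. Then for every integer $k \ge 1$, as $n \to \infty$, the random vector $$\left(\frac{\mathrm{tr}(A^j) - d^j}{\sqrt{d^j}}\right)_{1 \le j \le k} \quad\text{converges in law to}\quad \big(\sqrt{j}\, N_j + \mathbf 1_{\{j \text{ is even}\}}\big)_{1 \le j \le k}.$$ 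-/

import Mathlib

open MeasureTheory ProbabilityTheory Filter Asymptotics
open scoped NNReal

/-- A permutation group of a finite set carries its discrete σ-algebra. -/
instance permFinMeasurableSpace (n : ℕ) : MeasurableSpace (Equiv.Perm (Fin n)) := ⊤

/-- `π 0, …, π (d - 1)` are independent random permutations of `{0, …, n - 1}`, each of them
uniformly distributed, on the probability space `(Ω, P)`. -/
structure IsIIDUniformPerm {Ω : Type*} [MeasurableSpace Ω] {n d : ℕ}
    (π : Fin d → Ω → Equiv.Perm (Fin n)) (P : Measure Ω) : Prop where
  hasLaw : ∀ q, HasLaw (π q) (uniformOn (Set.univ : Set (Equiv.Perm (Fin n)))) P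
  indep : iIndepFun π P

/-- The random matrix `A = P⁽¹⁾ + ⋯ + P⁽ᵈ⁾`, where `P⁽ᵠ⁾` is the permutation matrix of `π q`,
with entries `1` at the positions `(i, π q i)` and `0` elsewhere. -/
noncomputable def sumPermMatrix {Ω : Type*} {n d : ℕ}
    (π : Fin d → Ω → Equiv.Perm (Fin n)) (ω : Ω) : Matrix (Fin n) (Fin n) ℝ :=
  ∑ q, (π q ω).permMatrix ℝ

/-!
The proof compares characteristic functions by Stein's method.

The trace of `A ^ m` counts the closed walks of length `m` in the graph whose edges of label `q` are
`v → π q v` (`PermWalk.trace_sumPermMatrix_pow`). A closed walk either runs one or more times around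
a cycle that does not meet itself, whose length `p` divides `m`, or it is a *non-wrap*. Hence
`tr (A ^ m) = ∑ p ∣ m, X p + R m`, where `X p` is the number of rooted cycles of length `p` and `R m`
the number of non-wraps (`PermWalk.card_closedWalks`).

The main tool is a switching. Given distinct vertices `x 0, …, x (p - 1)` and labels `q i`,
redirect the edge of label `q i` at `x i` to `x (i + 1)` by composing with a transposition. This
turns the uniform distribution on tuples of permutations into the uniform distribution on those that
contain the cycle `(x, q)` (`PermWalk.sum_switch`). If no two of the `x i` are joined by a short
walk beforehand, which fails only with probability `O(d ^ C / n)`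
(`PermWalk.sum_card_badTuples_le`), then the switching adds exactly `p` closed walks of each length
divisible by `p`, affects no other short closed walk, and creates no non-wrap through the cycle
(`PermWalk.SwitchState.card_closedWalks`, `PermWalk.SwitchState.detours_eq_empty`). Consequently
`E R m` is small (`PermWalk.sum_card_nonWraps_le`) and
`E [X p f(tr A, tr A², …)] ≈ d ^ p E [f(tr A + p [p ∣ 1], tr A² + p [p ∣ 2], …)]`
for bounded `f` (`PermWalk.norm_sum_cycles_sub_le`), both with errors `O(d ^ C / n)`.

For `f = exp (i s ⟨θ, ·⟩)` this says that `φ(s) = E exp (i s ⟨θ, (tr A ^ j) j⟩)` nearly satisfies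
the linear differential equation of the characteristic function `exp ψ(s)` of
`⟨θ, (∑ ℓ ∣ j, ℓ Λ ℓ) j⟩`. Integrating `(φ exp (-ψ))'` gives
`|φ(1) - exp ψ(1)| = O(d ^ C / n)`, uniformly as long as `θ` and `Re ψ` stay bounded
(`PermWalk.norm_walkCharFun_sub_le`). For fixed `d` this is the first limit theorem. For growing `d`
take `θ j = t j / d ^ (j / 2)`; the Poisson exponent then converges to the Gaussian one
(`PermWalk.tendsto_poissonExponent`), where the mean `1` for even `j` comes from the cycles of length
`j / 2`. Lévy's theorem concludes.
-/

namespace PermWalk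

/-! ### Walks and periodic words -/

section Walk

variable {V Q α : Type*}

/-- The walk started at `a` whose `i`-th step is an application of the permutation `g (w i)`. -/
def walk (g : Q → Equiv.Perm V) (w : ℕ → Q) (a : V) : ℕ → V
  | 0 => a
  | i + 1 => g (w i) (walk g w a i)

/-- The `m`-periodic sequence extending a word of length `m`. -/
def per {m : ℕ} [NeZero m] (q : Fin m → α) (i : ℕ) : α := q (Fin.ofNat m i)

lemma per_periodic {m : ℕ} [NeZero m] (q : Fin m → α) : Function.Periodic (per q) m := by
  intro i
  simp only [per]
  congr 1
  ext
  simp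

@[simp] lemma per_fin {m : ℕ} [NeZero m] (q : Fin m → α) (i : Fin m) : per q i = q i := by
  simp [per]

lemma per_of_lt {m : ℕ} [NeZero m] (q : Fin m → α) {i : ℕ} (hi : i < m) :
    per q i = q ⟨i, hi⟩ :=
  per_fin q ⟨i, hi⟩

lemma per_injective {m : ℕ} [NeZero m] : Function.Injective (per : (Fin m → α) → ℕ → α) := by
  intro q q' h
  ext i
  rw [← per_fin q, ← per_fin q', h]

lemma per_restrict {m : ℕ} [NeZero m] {u : ℕ → α} (hu : Function.Periodic u m) :
    per (fun i : Fin m => u i) = u := by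
  ext i
  simp only [per, Fin.ofNat]
  exact hu.map_mod_nat i

lemma periodic_ext {m : ℕ} (hm : 0 < m) {u v : ℕ → α} (hu : Function.Periodic u m)
    (hv : Function.Periodic v m) (h : ∀ i < m, u i = v i) : u = v := by
  ext i
  rw [← hu.map_mod_nat i, ← hv.map_mod_nat i]
  exact h _ (Nat.mod_lt _ hm)

lemma periodic_of_dvd {p m : ℕ} {u : ℕ → α} (hu : Function.Periodic u p) (h : p ∣ m) :
    Function.Periodic u m := by
  obtain ⟨c, rfl⟩ := h
  intro i
  rw [mul_comm]
  exact hu.nat_mul c i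

lemma periodic_shift {p : ℕ} {u : ℕ → α} (hu : Function.Periodic u p) (s : ℕ) :
    Function.Periodic (fun i => u (s + i)) p := by
  intro i
  simp only [← add_assoc]
  exact hu _

variable (g : Q → Equiv.Perm V)

@[simp] lemma walk_zero (w : ℕ → Q) (a : V) : walk g w a 0 = a := rfl

lemma walk_succ (w : ℕ → Q) (a : V) (i : ℕ) : walk g w a (i + 1) = g (w i) (walk g w a i) := rfl

lemma walk_add (w : ℕ → Q) (a : V) (i j : ℕ) :
    walk g w a (i + j) = walk g (fun t => w (i + t)) (walk g w a i) j := by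
  induction j with
  | zero => rfl
  | succ j ih => rw [← add_assoc, walk_succ, walk_succ, ih]

lemma walk_succ' (w : ℕ → Q) (a : V) (i : ℕ) :
    walk g w a (i + 1) = walk g (fun t => w (t + 1)) (g (w 0) a) i := by
  rw [add_comm, walk_add]
  simp [add_comm, walk]

lemma walk_congr {w w' : ℕ → Q} (a : V) {r : ℕ} (h : ∀ i < r, w i = w' i) :
    walk g w a r = walk g w' a r := by
  induction r with
  | zero => rfl
  | succ r ih =>
    rw [walk_succ, walk_succ, ih fun i hi => h i (by omega), h r (by omega)]

lemma walk_start_injective (w : ℕ → Q) (i : ℕ) : Function.Injective fun a => walk g w a i := by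
  induction i with
  | zero => exact fun _ _ h => h
  | succ i ih => exact fun a b h => ih ((g (w i)).injective h)

lemma walk_periodic {w : ℕ → Q} {m : ℕ} (hw : Function.Periodic w m) {a : V}
    (h : walk g w a m = a) : Function.Periodic (walk g w a) m := by
  intro i
  rw [add_comm, walk_add, h]
  congr 1
  ext t
  rw [add_comm]
  exact hw t

/-- The sequence `x` of vertices and the sequence `q` of labels, both of period `p`, run around a
cycle of `g` that has length `p` and does not meet itself. -/
structure IsCycle (p : ℕ) (x : ℕ → V) (q : ℕ → Q) : Prop where
  x_per : Function.Periodic x p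
  q_per : Function.Periodic q p
  inj : ∀ i < p, ∀ j < p, x i = x j → i = j
  edge : ∀ i, g (q i) (x i) = x (i + 1)

/-- A periodic sequence with distinct values in a period takes equal values only at indices that
agree modulo the period. -/
lemma mod_eq_of_periodic_inj {p : ℕ} (hp : 0 < p) {x : ℕ → V} (hx : Function.Periodic x p)
    (hinj : ∀ i < p, ∀ j < p, x i = x j → i = j) {i j : ℕ} (h : x i = x j) : i % p = j % p := by
  rw [← hx.map_mod_nat i, ← hx.map_mod_nat j] at h
  exact hinj _ (Nat.mod_lt _ hp) _ (Nat.mod_lt _ hp) h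

variable {g}

lemma IsCycle.walk_eq {p : ℕ} {x : ℕ → V} {q : ℕ → Q} (h : IsCycle g p x q) (s i : ℕ) :
    walk g (fun t => q (s + t)) (x s) i = x (s + i) := by
  induction i with
  | zero => rfl
  | succ i ih => rw [walk_succ, ih, h.edge, add_assoc]

lemma IsCycle.walk_eq_zero {p : ℕ} {x : ℕ → V} {q : ℕ → Q} (h : IsCycle g p x q) (i : ℕ) :
    walk g q (x 0) i = x i := by
  simpa using h.walk_eq 0 i

lemma IsCycle.shift {p : ℕ} (hp : 0 < p) {x : ℕ → V} {q : ℕ → Q} (h : IsCycle g p x q) (s : ℕ) :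
    IsCycle g p (fun i => x (s + i)) (fun i => q (s + i)) where
  x_per := periodic_shift h.x_per s
  q_per := periodic_shift h.q_per s
  inj i hi j hj hij := by
    have h1 := mod_eq_of_periodic_inj hp h.x_per h.inj hij
    have h2 : i ≡ j [MOD p] := Nat.ModEq.add_left_cancel' s h1
    rwa [Nat.ModEq, Nat.mod_eq_of_lt hi, Nat.mod_eq_of_lt hj] at h2
  edge i := h.edge (s + i)

/-- The length of the cycle that a closed walk runs around is determined by the walk. -/
lemma IsCycle.length_unique {p p' : ℕ} (hp : 0 < p) (hp' : 0 < p') {x x' : ℕ → V} {q : ℕ → Q}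
    (h : IsCycle g p x q) (h' : IsCycle g p' x' q) (h0 : x 0 = x' 0) : p = p' := by
  have hx : x = x' := by
    ext i
    rw [← h.walk_eq_zero, ← h'.walk_eq_zero, h0]
  subst hx
  apply Nat.dvd_antisymm
  · have := mod_eq_of_periodic_inj hp h.x_per h.inj (i := 0 + p') (j := 0) (h'.x_per 0)
    exact Nat.dvd_of_mod_eq_zero (by simpa using this)
  · have := mod_eq_of_periodic_inj hp' h'.x_per h'.inj (i := 0 + p) (j := 0) (h.x_per 0)
    exact Nat.dvd_of_mod_eq_zero (by simpa using this)

/-- The rotation by `s` of a word of length `m`. -/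
def rot {m : ℕ} [NeZero m] (s : ℕ) (u : Fin m → Q) : Fin m → Q := fun i => per u (s + i)

lemma per_rot {m : ℕ} [NeZero m] (s : ℕ) (u : Fin m → Q) :
    per (rot s u) = fun i => per u (s + i) :=
  per_restrict (periodic_shift (per_periodic u) s)

lemma rot_injective {m : ℕ} [NeZero m] {s : ℕ} (hs : s ≤ m) :
    Function.Injective (rot s : (Fin m → Q) → Fin m → Q) := by
  intro u u' h
  have h1 : (fun i => per u (s + i)) = fun i => per u' (s + i) := by
    rw [← per_rot, ← per_rot, h]
  apply per_injective
  ext i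
  have := congrFun h1 (i + (m - s))
  have e : s + (i + (m - s)) = i + m := by omega
  simp only [e] at this
  rwa [per_periodic u, per_periodic u'] at this

/-- Every closed walk visits the root of a cycle that is not longer than the walk: take the piece of
the walk between two visits to the same vertex that are as close in time as possible. -/
lemma exists_cycle_of_closed {w : ℕ → Q} {m : ℕ} (hm : 0 < m) (hw : Function.Periodic w m) {a : V}
    (h : walk g w a m = a) :
    ∃ s < m, ∃ p, 0 < p ∧ p ≤ m ∧ ∃ x q, IsCycle g p x q ∧ x 0 = walk g w a s := by
  classical
  have hper := walk_periodic g hw h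
  have hex : ∃ p, 0 < p ∧ ∃ s, walk g w a (s + p) = walk g w a s := ⟨m, hm, 0, by simpa using h⟩
  obtain ⟨hp, s, hs⟩ := Nat.find_spec hex
  have hmin : ∀ p', 0 < p' → ∀ s', walk g w a (s' + p') = walk g w a s' → Nat.find hex ≤ p' :=
    fun p' hp' s' hs' => Nat.find_min' hex ⟨hp', s', hs'⟩
  set p := Nat.find hex with hpdef
  refine ⟨s % m, Nat.mod_lt _ hm, p, hp, hmin m hm 0 (by simpa using h),
    fun i => walk g w a (s + i % p), fun i => w (s + i % p), ⟨?_, ?_, ?_, ?_⟩, ?_⟩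
  · intro i; simp
  · intro i; simp
  · intro i hi j hj hij
    simp only [Nat.mod_eq_of_lt hi, Nat.mod_eq_of_lt hj] at hij
    rcases lt_trichotomy i j with hlt | heq | hlt
    · have := hmin (j - i) (by omega) (s + i) (by
        rw [hij]; congr 1; omega)
      omega
    · exact heq
    · have := hmin (i - j) (by omega) (s + j) (by
        rw [← hij]; congr 1; omega)
      omega
  · intro i
    have hlt := Nat.mod_lt i hp
    rw [← walk_succ]
    rcases Nat.lt_or_ge (i % p + 1) p with h1 | h1
    · rw [Nat.add_mod i 1 p, Nat.mod_eq_of_lt (a := 1) (by omega), Nat.mod_eq_of_lt h1, add_assoc]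
    · have h2 : i % p + 1 = p := by omega
      have h3 : (i + 1) % p = 0 := by
        rw [← Nat.mod_add_mod, h2, Nat.mod_self]
      rw [h3, add_assoc, h2, hs, add_zero]
  · simp only [Nat.zero_mod, add_zero]
    exact (hper.map_mod_nat s).symm

end Walk

/-! ### Counting closed walks and cycles -/

section Count

variable {V Q : Type*} [Fintype V] [Fintype Q]

open Classical in
/-- The closed walks of length `m`, given by their starting points and their words. -/
noncomputable def closedWalks (g : Q → Equiv.Perm V) (m : ℕ) [NeZero m] :
    Finset (V × (Fin m → Q)) :=
  Finset.univ.filter fun z => walk g (per z.2) z.1 m = z.1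

open Classical in
/-- The rooted cycles of length `p`, given by their vertices and labels. -/
noncomputable def cycles (g : Q → Equiv.Perm V) (p : ℕ) [NeZero p] :
    Finset ((Fin p → V) × (Fin p → Q)) :=
  Finset.univ.filter fun z => IsCycle g p (per z.1) (per z.2)

/-- The closed walk of length `m` (given by its starting point and its word) runs around a cycle
one or more times. -/
def IsWrap (g : Q → Equiv.Perm V) {m : ℕ} [NeZero m] (z : V × (Fin m → Q)) : Prop :=
  ∃ p, 0 < p ∧ p ∣ m ∧ ∃ x, IsCycle g p x (per z.2) ∧ x 0 = z.1

open Classical in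
/-- The closed walks of length `m` that do not just run around a cycle. -/
noncomputable def nonWraps (g : Q → Equiv.Perm V) (m : ℕ) [NeZero m] :
    Finset (V × (Fin m → Q)) :=
  (closedWalks g m).filter fun z => ¬ IsWrap g z

open Classical in
/-- The words of length `m` that lead from `x 0` back to `x 0` other than by repeating the
`p`-periodic word `q`. -/
noncomputable def detours (g : Q → Equiv.Perm V) (p m : ℕ) [NeZero m] (x : ℕ → V) (q : ℕ → Q) :
    Finset (Fin m → Q) :=
  Finset.univ.filter fun u => walk g (per u) (x 0) m = x 0 ∧ ¬ (p ∣ m ∧ per u = q)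

variable (g : Q → Equiv.Perm V)

lemma mem_closedWalks {m : ℕ} [NeZero m] {z : V × (Fin m → Q)} :
    z ∈ closedWalks g m ↔ walk g (per z.2) z.1 m = z.1 := by
  simp [closedWalks]

lemma mem_cycles {p : ℕ} [NeZero p] {z : (Fin p → V) × (Fin p → Q)} :
    z ∈ cycles g p ↔ IsCycle g p (per z.1) (per z.2) := by
  simp [cycles]

open Classical in
/-- The closed walks that run around some cycle of length `p` are as many as the rooted cycles of
length `p`. -/
lemma card_wraps_eq {p m : ℕ} [NeZero p] [NeZero m] (h : p ∣ m) :
    ((closedWalks g m).filter fun z => ∃ x, IsCycle g p x (per z.2) ∧ x 0 = z.1).card =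
      (cycles g p).card := by
  classical
  symm
  refine Finset.card_bij (fun z _ => (z.1 0, fun i : Fin m => per z.2 i)) ?_ ?_ ?_
  · intro z hz
    rw [mem_cycles] at hz
    have h2 : per (fun i : Fin m => per z.2 i) = per z.2 :=
      per_restrict (periodic_of_dvd (per_periodic _) h)
    have h0 : per z.1 0 = z.1 0 := per_of_lt _ (NeZero.pos p)
    simp only [Finset.mem_filter, mem_closedWalks, h2]
    refine ⟨?_, per z.1, hz, h0⟩
    rw [← h0, hz.walk_eq_zero]
    simpa using (periodic_of_dvd hz.x_per h) 0
  · intro z hz z' hz' heq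
    rw [mem_cycles] at hz hz'
    simp only [Prod.mk.injEq] at heq
    have h2 : per z.2 = per z'.2 := by
      rw [← per_restrict (periodic_of_dvd (per_periodic z.2) h),
        ← per_restrict (periodic_of_dvd (per_periodic z'.2) h), heq.2]
    have h1 : per z.1 = per z'.1 := by
      ext i
      rw [← hz.walk_eq_zero, ← hz'.walk_eq_zero, h2]
      congr 1
      rw [per_of_lt _ (NeZero.pos p), per_of_lt _ (NeZero.pos p)]
      exact heq.1
    exact Prod.ext (per_injective h1) (per_injective h2)
  · rintro ⟨a, u⟩ hz
    simp only [Finset.mem_filter] at hz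
    obtain ⟨-, x, hx, h0⟩ := hz
    refine ⟨(fun i : Fin p => x i, fun i : Fin p => per u i), ?_, ?_⟩
    · rw [mem_cycles, per_restrict hx.x_per, per_restrict hx.q_per]
      exact hx
    · ext i
      · simpa using h0
      · simp only [per_restrict hx.q_per, per_fin]

/-- A closed walk either runs around a cycle whose length divides its own, or is a non-wrap. -/
theorem card_closedWalks (j : ℕ) :
    (closedWalks g (j + 1)).card =
      ∑ p ∈ Finset.range (j + 1), (if p + 1 ∣ j + 1 then (cycles g (p + 1)).card else 0) +
        (nonWraps g (j + 1)).card := by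
  classical
  rw [nonWraps, ← Finset.card_filter_add_card_filter_not (s := closedWalks g (j + 1))
    (fun z => IsWrap g z)]
  congr 1
  rw [← Finset.sum_filter]
  have : ∀ p ∈ (Finset.range (j + 1)).filter (fun p => p + 1 ∣ j + 1), (cycles g (p + 1)).card =
      ((closedWalks g (j + 1)).filter
        fun z => ∃ x, IsCycle g (p + 1) x (per z.2) ∧ x 0 = z.1).card := by
    intro p hp
    rw [card_wraps_eq g (Finset.mem_filter.1 hp).2]
  rw [Finset.sum_congr rfl this, ← Finset.card_biUnion]
  · congr 1
    ext z
    simp only [Finset.mem_filter, Finset.mem_biUnion, Finset.mem_range]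
    constructor
    · rintro ⟨hz, p, hp, hd, x, hx⟩
      refine ⟨p - 1, ⟨?_, ?_⟩, hz, x, ?_⟩
      · have := Nat.le_of_dvd (Nat.succ_pos _) hd
        omega
      · rwa [Nat.sub_add_cancel hp]
      · rwa [Nat.sub_add_cancel hp]
    · rintro ⟨p, ⟨-, hd⟩, hz, x, hx⟩
      exact ⟨hz, p + 1, Nat.succ_pos _, hd, x, hx⟩
  · intro p _ p' _ hne
    rw [Function.onFun, Finset.disjoint_left]
    intro z hz hz'
    obtain ⟨-, x, hx, h0⟩ := Finset.mem_filter.1 hz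
    obtain ⟨-, x', hx', h0'⟩ := Finset.mem_filter.1 hz'
    have := hx.length_unique (Nat.succ_pos _) (Nat.succ_pos _) hx' (h0.trans h0'.symm)
    omega

/-- A closed walk is determined by its rotation by `s`, and the rotation by a suitable `s` starts
at the root of a cycle that is not longer than the walk. So the closed walks in `S` are at most `m`
times as many as the pairs of a rooted cycle `(x, q)` of length `p ≤ m` and a word in `A p _ x q`,
if these sets of words contain the rotations that occur. -/
lemma card_le_of_rotation {m : ℕ} [NeZero m] (S : Finset (V × (Fin m → Q)))
    (hS : S ⊆ closedWalks g m)
    (A : ∀ p, 0 < p → (ℕ → V) → (ℕ → Q) → Finset (Fin m → Q))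
    (hA : ∀ z ∈ S, ∀ s < m, ∀ p (hp : 0 < p) x q, p ≤ m → IsCycle g p x q →
      x 0 = walk g (per z.2) z.1 s → rot s z.2 ∈ A p hp x q) :
    S.card ≤ m * ∑ p ∈ Finset.range m, ∑ c ∈ cycles g (p + 1),
      (A (p + 1) (Nat.succ_pos p) (per c.1) (per c.2)).card := by
  classical
  let B : Finset (Σ _ : ℕ, Σ p : ℕ, Σ _ : (Fin (p + 1) → V) × (Fin (p + 1) → Q), Fin m → Q) :=
    (Finset.range m).sigma fun _ => (Finset.range m).sigma fun p => (cycles g (p + 1)).sigma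
      fun c => A (p + 1) (Nat.succ_pos p) (per c.1) (per c.2)
  have hB : B.card = m * ∑ p ∈ Finset.range m, ∑ c ∈ cycles g (p + 1),
      (A (p + 1) (Nat.succ_pos p) (per c.1) (per c.2)).card := by
    simp only [B, Finset.card_sigma, Finset.sum_const, Finset.card_range, smul_eq_mul]
  rw [← hB]
  have key : ∀ z ∈ S, ∃ b ∈ B, b.1 < m ∧ b.2.2.1.1 0 = walk g (per z.2) z.1 b.1 ∧
      rot b.1 z.2 = b.2.2.2 := by
    intro z hz
    obtain ⟨s, hs, p, hp, hpm, x, q, hc, h0⟩ := exists_cycle_of_closed (NeZero.pos m)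
      (per_periodic z.2) ((mem_closedWalks g).1 (hS hz))
    obtain ⟨p, rfl⟩ : ∃ p', p = p' + 1 := ⟨p - 1, by omega⟩
    have e1 := per_restrict hc.x_per
    have e2 := per_restrict hc.q_per
    refine ⟨⟨s, p, (fun i => x i, fun i => q i), rot s z.2⟩, ?_, hs, ?_, rfl⟩
    · simp only [B, Finset.mem_sigma, Finset.mem_range]
      refine ⟨hs, hpm, ?_, ?_⟩
      · rw [mem_cycles]
        simp only [e1, e2]
        exact hc
      · simp only [e1, e2]
        exact hA z hz s hs (p + 1) hp x q hpm hc h0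
    · simpa using h0
  refine Finset.card_le_card_of_forall_subsingleton (fun z b => b.1 < m ∧
    b.2.2.1.1 0 = walk g (per z.2) z.1 b.1 ∧ rot b.1 z.2 = b.2.2.2) key ?_
  rintro b - z ⟨-, hs, hz1, hz2⟩ z' ⟨-, -, hz1', hz2'⟩
  have h1 : z.2 = z'.2 := rot_injective hs.le (hz2.trans hz2'.symm)
  have h2 : z.1 = z'.1 := by
    apply walk_start_injective g (per z.2) b.1
    rw [h1] at hz1 ⊢
    exact hz1.symm.trans hz1'
  exact Prod.ext h2 h1

/-- Rotate to the root of a cycle and forget everything about the word. -/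
theorem card_closedWalks_le (m : ℕ) [NeZero m] :
    (closedWalks g m).card ≤
      m * ∑ p ∈ Finset.range m, (cycles g (p + 1)).card * Fintype.card Q ^ m := by
  classical
  refine (card_le_of_rotation g (closedWalks g m) subset_rfl (fun _ _ _ _ => Finset.univ)
    (fun _ _ _ _ _ _ _ _ _ _ _ => Finset.mem_univ _)).trans (le_of_eq ?_)
  simp

/-- A non-wrap that is rotated to the root of a cycle becomes a detour from this cycle. -/
theorem card_nonWraps_le (m : ℕ) [NeZero m] :
    (nonWraps g m).card ≤ m * ∑ p ∈ Finset.range m, ∑ c ∈ cycles g (p + 1),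
      (detours g (p + 1) m (per c.1) (per c.2)).card := by
  classical
  refine card_le_of_rotation g (nonWraps g m) (Finset.filter_subset _ _)
    (fun p _ x q => detours g p m x q) ?_
  intro z hz s hs p hp x q hpm hc h0
  simp only [nonWraps, Finset.mem_filter, mem_closedWalks] at hz
  obtain ⟨hcl, hnw⟩ := hz
  have hper := walk_periodic g (per_periodic z.2) hcl
  simp only [detours, Finset.mem_filter, Finset.mem_univ, true_and, per_rot]
  refine ⟨?_, ?_⟩
  · rw [h0, ← walk_add]
    exact hper s
  -- If the rotated walk ran around the cycle, so would the walk itself: rotate back.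
  · rintro ⟨hd, hq⟩
    apply hnw
    have hq' : ∀ i, per z.2 (s + i) = q i := fun i => congrFun hq i
    refine ⟨p, hp, hd, fun i => x ((m - s) + i), ?_, ?_⟩
    · have := hc.shift hp (m - s)
      convert this using 1
      ext i
      rw [← hq', ← add_assoc, Nat.add_sub_of_le hs.le, add_comm, per_periodic]
    · simp only [add_zero]
      rw [← hc.walk_eq_zero, h0, ← hq, ← walk_add, Nat.add_sub_of_le hs.le, hcl]

end Count

/-! ### Switching a cycle into a tuple of permutations -/

section Switch

variable {V Q : Type*} [DecidableEq V] [DecidableEq Q]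

/-- Redirect the edge of label `c` at `a` to `b`; the edge of label `c` that pointed to `b` is
redirected to the former end of the edge at `a`. -/
def rewire (g : Q → Equiv.Perm V) (c : Q) (a b : V) : Q → Equiv.Perm V :=
  Function.update g c (Equiv.swap (g c a) b * g c)

/-- Redirect one after the other the edges of label `q i` at `x i` to `x (i + 1)`. -/
def switch (g : Q → Equiv.Perm V) (x : ℕ → V) (q : ℕ → Q) : ℕ → Q → Equiv.Perm V
  | 0 => g
  | i + 1 => rewire (switch g x q i) (q i) (x i) (x (i + 1))

omit [DecidableEq V] [DecidableEq Q] in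
/-- `Reach g a r b`: some walk of `g` leads in `r` steps from `a` to `b`. -/
inductive Reach (g : Q → Equiv.Perm V) (a : V) : ℕ → V → Prop
  | zero : Reach g a 0 a
  | step {r : ℕ} {b : V} (c : Q) : Reach g a r b → Reach g a (r + 1) (g c b)

/-- No walk of `g` of a positive length up to `K` leads from one term of `x` to another, or back
to itself. -/
def Scattered (g : Q → Equiv.Perm V) (K : ℕ) (x : ℕ → V) : Prop :=
  ∀ i j r, 0 < r → r ≤ K → ¬ Reach g (x i) r (x j)

lemma rewire_of_ne (g : Q → Equiv.Perm V) {c p : Q} (a b v : V) (h : p ≠ c) :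
    rewire g c a b p v = g p v := by
  simp [rewire, h]

lemma rewire_self (g : Q → Equiv.Perm V) (c : Q) (a b : V) : rewire g c a b c a = b := by
  simp [rewire]

lemma rewire_of_eq (g : Q → Equiv.Perm V) (c : Q) (a b v : V) (h : g c v = b) :
    rewire g c a b c v = g c a := by
  simp [rewire, h]

lemma rewire_of_ne_of_ne (g : Q → Equiv.Perm V) (c : Q) (a b v : V) (h : g c v ≠ b) (hv : v ≠ a) :
    rewire g c a b c v = g c v := by
  simp only [rewire, Function.update_self, Equiv.Perm.coe_mul, Function.comp_apply]
  exact Equiv.swap_apply_of_ne_of_ne (fun h' => hv ((g c).injective h')) h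

omit [DecidableEq V] [DecidableEq Q] in
lemma Scattered.ne {g : Q → Equiv.Perm V} {K : ℕ} {x : ℕ → V} (h : Scattered g K x) (hK : 1 ≤ K)
    (i j : ℕ) (p : Q) : g p (x i) ≠ x j := by
  intro e
  have := h i j 1 one_pos hK
  rw [← e] at this
  exact this (Reach.step p Reach.zero)

/-- The effect of the first `i` redirections on a tuple in which `x` is scattered. -/
structure SwitchState (g h : Q → Equiv.Perm V) (ℓ : ℕ) (x : ℕ → V) (q : ℕ → Q) (i : ℕ) :
    Prop where
  new : ∀ j < i, h (q j) (x j) = x (j + 1)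
  old : ∀ j < ℓ, ∀ p, (p ≠ q j ∨ i ≤ j) → h p (x j) = g p (x j)
  off : ∀ v, (∀ j, v ≠ x j) → ∀ p,
    h p v = g p v ∨ ((∃ j, g p v = x j) ∧ ∃ j, h p v = g p (x j))

/-- As no old edge leads from `x` to `x`, the redirections do not interfere with each other. -/
lemma switchState {g : Q → Equiv.Perm V} {K ℓ : ℕ} {x : ℕ → V} {q : ℕ → Q} (hK : 1 ≤ K)
    (hg : Scattered g K x) (hx : Function.Periodic x ℓ)
    (hinj : ∀ i < ℓ, ∀ j < ℓ, x i = x j → i = j) (i : ℕ) (hi : i ≤ ℓ) :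
    SwitchState g (switch g x q i) ℓ x q i := by
  induction i with
  | zero => exact ⟨by simp, fun _ _ _ _ => rfl, fun _ _ _ => Or.inl rfl⟩
  | succ i ih =>
    obtain ⟨hnew, hold, hoff⟩ := ih (by omega)
    have hi0 : switch g x q i (q i) (x i) = g (q i) (x i) := hold i (by omega) _ (Or.inr le_rfl)
    have hinj' : ∀ j < i, x (j + 1) ≠ x (i + 1) := by
      intro j hj e
      have := mod_eq_of_periodic_inj (by omega : 0 < ℓ) hx hinj e
      have h2 : j ≡ i [MOD ℓ] := Nat.ModEq.add_right_cancel' 1 this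
      rw [Nat.ModEq, Nat.mod_eq_of_lt (by omega), Nat.mod_eq_of_lt (by omega)] at h2
      omega
    have hne : ∀ j < ℓ, j ≠ i → x j ≠ x i := fun j hj hji e =>
      hji (hinj j hj i (by omega) e)
    refine ⟨?_, ?_, ?_⟩
    · intro j hj
      rcases Nat.lt_succ_iff_lt_or_eq.1 hj with hj | rfl
      · by_cases hq : q j = q i
        · have := hnew j hj
          rw [hq] at this ⊢
          rw [switch, rewire_of_ne_of_ne _ _ _ _ _ (this ▸ hinj' j hj)
            (hne j (by omega) (by omega)), this]
        · rw [switch, rewire_of_ne _ _ _ _ hq, hnew j hj]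
      · exact rewire_self _ _ _ _
    · intro j hj p hp
      by_cases hpq : p = q i
      · subst hpq
        have hji : j ≠ i := by
          rintro rfl
          rcases hp with hp | hp
          · exact hp rfl
          · omega
        have h1 : switch g x q i (q i) (x j) = g (q i) (x j) :=
          hold j hj _ (hp.imp_right fun h => by omega)
        rw [switch, rewire_of_ne_of_ne _ _ _ _ _ (h1 ▸ hg.ne hK _ _ _) (hne j hj hji), h1]
      · rw [switch, rewire_of_ne _ _ _ _ hpq]
        exact hold j hj p (hp.imp_right fun h => by omega)
    · intro v hv p
      by_cases hpq : p = q i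
      · subst hpq
        by_cases hb : switch g x q i (q i) v = x (i + 1)
        · right
          refine ⟨?_, i, ?_⟩
          · rcases hoff v hv (q i) with h | h
            · exact ⟨i + 1, h ▸ hb⟩
            · exact h.1
          · rw [switch, rewire_of_eq _ _ _ _ _ hb, hi0]
        · rw [switch, rewire_of_ne_of_ne _ _ _ _ _ hb (hv i)]
          exact hoff v hv _
      · rw [switch, rewire_of_ne _ _ _ _ hpq]
        exact hoff v hv p

section Final

variable {g h : Q → Equiv.Perm V} {K ℓ : ℕ} {x : ℕ → V} {q : ℕ → Q}

omit [DecidableEq V] [DecidableEq Q] in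
/-- A walk of the switched tuple that starts with an old edge at some `x i` follows old edges only,
and in particular does not come back to `x` for a long time. -/
lemma SwitchState.reach_of_escape (hh : SwitchState g h ℓ x q ℓ) (hg : Scattered g K x) (w : ℕ → Q)
    (i : ℕ) (p : Q) (s : ℕ) (hs : s + 1 ≤ K) :
    ∃ r, 0 < r ∧ r ≤ s + 1 ∧ Reach g (x i) r (walk h w (g p (x i)) s) := by
  induction s with
  | zero => exact ⟨1, one_pos, le_rfl, Reach.step p Reach.zero⟩
  | succ s ih =>
    obtain ⟨r, hr, hrs, hreach⟩ := ih (by omega)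
    set u := walk h w (g p (x i)) s
    have hu : ∀ j, u ≠ x j := fun j e => hg i j r hr (by omega) (e ▸ hreach)
    refine ⟨r + 1, by omega, by omega, ?_⟩
    rw [walk_succ]
    rcases hh.off u hu (w s) with e | ⟨⟨j, e⟩, -⟩
    · rw [e]
      exact Reach.step _ hreach
    · exact absurd (e ▸ Reach.step (w s) hreach) (hg i j (r + 1) (by omega) (by omega))

omit [DecidableEq V] [DecidableEq Q] in
lemma SwitchState.edge (hh : SwitchState g h ℓ x q ℓ) (hℓ : 0 < ℓ) (hx : Function.Periodic x ℓ)
    (hq : Function.Periodic q ℓ) (i : ℕ) : h (q i) (x i) = x (i + 1) := by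
  have := hh.new (i % ℓ) (Nat.mod_lt _ hℓ)
  rw [hx.map_mod_nat, hq.map_mod_nat] at this
  rw [this, ← hx.map_mod_nat (i + 1), ← Nat.mod_add_mod, hx.map_mod_nat]

omit [DecidableEq V] [DecidableEq Q] in
lemma SwitchState.old_edge (hh : SwitchState g h ℓ x q ℓ) (hℓ : 0 < ℓ) (hx : Function.Periodic x ℓ)
    (hq : Function.Periodic q ℓ) (i : ℕ) {p : Q} (hp : p ≠ q i) : h p (x i) = g p (x i) := by
  have := hh.old (i % ℓ) (Nat.mod_lt _ hℓ) p (Or.inl (by rwa [hq.map_mod_nat]))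
  rwa [hx.map_mod_nat] at this

omit [DecidableEq V] [DecidableEq Q] in
/-- A short walk of the switched tuple from `x` to `x` goes along the new cycle. -/
lemma SwitchState.walk_on_cycle (hh : SwitchState g h ℓ x q ℓ) (hg : Scattered g K x) (hℓ : 0 < ℓ)
    (hx : Function.Periodic x ℓ) (hq : Function.Periodic q ℓ) {w : ℕ → Q} {i j m : ℕ}
    (hm : m ≤ K) (hw : walk h w (x i) m = x j) :
    ∀ s ≤ m, walk h w (x i) s = x (i + s) ∧ ∀ t < s, w t = q (i + t) := by
  intro s
  induction s with
  | zero => simp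
  | succ s ih =>
    intro hs
    obtain ⟨h1, h2⟩ := ih (by omega)
    have hws : w s = q (i + s) := by
      by_contra hne
      have e := hh.old_edge hℓ hx hq (i + s) hne
      obtain ⟨r, hr, hrs, hreach⟩ := hh.reach_of_escape hg (fun t => w (s + 1 + t)) (i + s) (w s)
        (m - (s + 1)) (by omega)
      have e' : g (w s) (x (i + s)) = walk h w (x i) (s + 1) := by rw [walk_succ, h1, e]
      rw [e', ← walk_add, Nat.add_sub_of_le hs, hw] at hreach
      exact hg _ _ r hr (by omega) hreach
    refine ⟨?_, ?_⟩
    · rw [walk_succ, h1, hws, hh.edge hℓ hx hq, add_assoc]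
    · intro t ht
      rcases Nat.lt_succ_iff_lt_or_eq.1 ht with ht | rfl
      · exact h2 t ht
      · exact hws

omit [DecidableEq V] [DecidableEq Q] in
lemma SwitchState.closed_on_cycle (hh : SwitchState g h ℓ x q ℓ) (hg : Scattered g K x) (hℓ : 0 < ℓ)
    (hx : Function.Periodic x ℓ) (hq : Function.Periodic q ℓ)
    (hinj : ∀ i < ℓ, ∀ j < ℓ, x i = x j → i = j) {w : ℕ → Q} {i m : ℕ} (hm0 : 0 < m)
    (hm : m ≤ K) (hwp : Function.Periodic w m) (hw : walk h w (x i) m = x i) :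
    ℓ ∣ m ∧ w = fun t => q (i + t) := by
  have key := hh.walk_on_cycle hg hℓ hx hq hm hw m le_rfl
  have hd : ℓ ∣ m := by
    have e : x (i + m) = x (i + 0) := by rw [← key.1, hw, add_zero]
    have := mod_eq_of_periodic_inj hℓ hx hinj e
    exact (Nat.modEq_zero_iff_dvd.1 (Nat.ModEq.add_left_cancel' i this))
  exact ⟨hd, periodic_ext hm0 hwp (periodic_of_dvd (periodic_shift hq i) hd) key.2⟩

omit [DecidableEq V] [DecidableEq Q] in
lemma Reach.of_walk (g : Q → Equiv.Perm V) (w : ℕ → Q) (a : V) (r : ℕ) :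
    Reach g a r (walk g w a r) := by
  induction r with
  | zero => exact Reach.zero
  | succ r ih => exact Reach.step _ ih

omit [DecidableEq V] [DecidableEq Q] in
/-- Short closed walks of the original tuple do not meet `x`. -/
lemma Scattered.walk_ne (hg : Scattered g K x) {w : ℕ → Q} {a : V} {m : ℕ} (hm0 : 0 < m)
    (hm : m ≤ K) (hwp : Function.Periodic w m) (hw : walk g w a m = a) (s j : ℕ) :
    walk g w a s ≠ x j := by
  intro e
  refine hg j j m hm0 hm ?_
  have := Reach.of_walk g (fun t => w (s + t)) (x j) m
  rwa [← e, ← walk_add, walk_periodic g hwp hw, e] at this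

omit [DecidableEq V] [DecidableEq Q] in
/-- Short closed walks of the original tuple survive the switching. -/
lemma SwitchState.walk_eq_of_old (hh : SwitchState g h ℓ x q ℓ) (hg : Scattered g K x) {w : ℕ → Q}
    {a : V} {m : ℕ} (hm0 : 0 < m) (hm : m ≤ K) (hwp : Function.Periodic w m)
    (hw : walk g w a m = a) (s : ℕ) : walk h w a s = walk g w a s := by
  have hne := hg.walk_ne hm0 hm hwp hw
  induction s with
  | zero => rfl
  | succ s ih =>
    rw [walk_succ, ih, walk_succ]
    rcases hh.off _ (hne s) (w s) with e | ⟨⟨j, e⟩, -⟩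
    · exact e
    · exact absurd e (hne (s + 1) j)

omit [DecidableEq V] [DecidableEq Q] in
/-- Short closed walks of the switched tuple that do not meet the new cycle are old ones. -/
lemma SwitchState.walk_eq_of_new (hh : SwitchState g h ℓ x q ℓ) (hg : Scattered g K x) {w : ℕ → Q}
    {a : V} {m : ℕ} (hm0 : 0 < m) (hm : m + 1 ≤ K) (hwp : Function.Periodic w m)
    (hw : walk h w a m = a) (hne : ∀ s j, walk h w a s ≠ x j) (s : ℕ) :
    walk h w a s = walk g w a s := by
  have hper := walk_periodic h hwp hw
  induction s with
  | zero => rfl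
  | succ s ih =>
    rw [walk_succ g, ← ih, walk_succ]
    rcases hh.off _ (hne s) (w s) with e | ⟨⟨j, e⟩, j', e'⟩
    · exact e
    -- The walk uses the edge `w → z` created by the redirection at `j'`. As it is closed, it comes
    -- back to `w` from `z`, so that `g` leads from `x j'` through `z` and `w` to `x j`.
    · exfalso
      obtain ⟨r, hr, hrm, hreach⟩ := hh.reach_of_escape hg (fun t => w (s + 1 + t)) j' (w s)
        (m - 1) (by omega)
      rw [← e', ← walk_succ, ← walk_add, show s + 1 + (m - 1) = s + m by omega, hper] at hreach
      exact hg j' j (r + 1) (by omega) (by omega) (e ▸ Reach.step (w s) hreach)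

end Final

section CountSwitch

variable [Fintype V] [Fintype Q] {g h : Q → Equiv.Perm V} {K ℓ : ℕ} {x : ℕ → V} {q : ℕ → Q}

omit [DecidableEq V] [DecidableEq Q] in
/-- Switching in a cycle of length `ℓ` creates `ℓ` closed walks of length `m` if `ℓ` divides `m`,
and destroys or creates no others. -/
theorem SwitchState.card_closedWalks (hh : SwitchState g h ℓ x q ℓ) (hg : Scattered g K x)
    (hℓ : 0 < ℓ) (hx : Function.Periodic x ℓ) (hq : Function.Periodic q ℓ)
    (hinj : ∀ i < ℓ, ∀ j < ℓ, x i = x j → i = j) {m : ℕ} [NeZero m] (hm : m + 1 ≤ K) :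
    (closedWalks h m).card = (closedWalks g m).card + if ℓ ∣ m then ℓ else 0 := by
  classical
  have hm0 : 0 < m := NeZero.pos m
  rw [← Finset.card_filter_add_card_filter_not (s := closedWalks h m)
    (fun z => ∀ s j, walk h (per z.2) z.1 s ≠ x j)]
  congr 1
  · congr 1
    ext z
    simp only [Finset.mem_filter, mem_closedWalks]
    constructor
    · rintro ⟨h1, h2⟩
      rw [← hh.walk_eq_of_new hg hm0 hm (per_periodic z.2) h1 h2, h1]
    · intro h1
      have e := hh.walk_eq_of_old hg hm0 (by omega) (per_periodic z.2) h1
      refine ⟨by rw [e, h1], fun s j => ?_⟩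
      rw [e]
      exact hg.walk_ne hm0 (by omega) (per_periodic z.2) h1 s j
  · have key : ∀ z : V × (Fin m → Q), z ∈ closedWalks h m →
        (¬ ∀ s j, walk h (per z.2) z.1 s ≠ x j) →
        ℓ ∣ m ∧ ∃ i < ℓ, z.1 = x i ∧ per z.2 = fun t => q (i + t) := by
      intro z hz hmeet
      rw [mem_closedWalks] at hz
      push Not at hmeet
      obtain ⟨s, j, hs⟩ := hmeet
      have hper := walk_periodic h (per_periodic z.2) hz
      have hs' : walk h (per z.2) z.1 (s % m) = x j := by rw [hper.map_mod_nat, hs]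
      have hlt := Nat.mod_lt s hm0
      set s' := s % m
      have hcl : walk h (fun t => per z.2 (s' + t)) (x j) m = x j := by
        rw [← hs', ← walk_add]
        exact hper s'
      have h1 : z.1 = x (j + (m - s')) := by
        rw [← (hh.walk_on_cycle hg hℓ hx hq (by omega) hcl (m - s') (by omega)).1, ← hs',
          ← walk_add, Nat.add_sub_of_le hlt.le, hz]
      rw [← hx.map_mod_nat] at h1
      rw [h1] at hz
      obtain ⟨hd, hw⟩ := hh.closed_on_cycle hg hℓ hx hq hinj hm0 (by omega) (per_periodic z.2) hz
      exact ⟨hd, _, Nat.mod_lt _ hℓ, h1, hw⟩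
    split_ifs with hd
    · have : ℓ = (Finset.range ℓ).card := by simp
      conv_rhs => rw [this]
      symm
      have hpi : ∀ i, per (fun t : Fin m => q (i + t)) = fun t => q (i + t) := fun i =>
        per_restrict (periodic_of_dvd (periodic_shift hq i) hd)
      refine Finset.card_bij (fun i _ => (x i, fun t : Fin m => q (i + t))) ?_ ?_ ?_
      · intro i _
        simp only [Finset.mem_filter, mem_closedWalks, hpi]
        have hc : IsCycle h ℓ x q := ⟨hx, hq, hinj, hh.edge hℓ hx hq⟩
        refine ⟨?_, ?_⟩
        · rw [hc.walk_eq]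
          exact periodic_of_dvd hx hd i
        · push Not
          exact ⟨0, i, rfl⟩
      · intro i hi j hj e
        exact hinj i (Finset.mem_range.1 hi) j (Finset.mem_range.1 hj) (Prod.ext_iff.1 e).1
      · intro z hz
        obtain ⟨hz1, hz2⟩ := Finset.mem_filter.1 hz
        obtain ⟨-, i, hi, h1, h2⟩ := key z hz1 hz2
        refine ⟨i, Finset.mem_range.2 hi, Prod.ext h1.symm (per_injective ?_)⟩
        rw [hpi, h2]
    · rw [Finset.card_eq_zero, Finset.filter_eq_empty_iff]
      exact fun z hz hmeet => hd (key z hz hmeet).1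

omit [DecidableEq V] [DecidableEq Q] [Fintype V] in
lemma SwitchState.detours_eq_empty (hh : SwitchState g h ℓ x q ℓ) (hg : Scattered g K x)
    (hℓ : 0 < ℓ) (hx : Function.Periodic x ℓ) (hq : Function.Periodic q ℓ)
    (hinj : ∀ i < ℓ, ∀ j < ℓ, x i = x j → i = j) {m : ℕ} [NeZero m] (hm : m ≤ K) :
    detours h ℓ m x q = ∅ := by
  classical
  rw [detours, Finset.filter_eq_empty_iff]
  rintro u - ⟨h1, h2⟩
  obtain ⟨hd, hw⟩ := hh.closed_on_cycle hg hℓ hx hq hinj (NeZero.pos m) hm (per_periodic u) h1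
  exact h2 ⟨hd, by simpa using hw⟩

end CountSwitch

/-! ### The switching is uniform on the tuples that contain the cycle -/

section Uniform

variable [Fintype V] [Fintype Q]

omit [Fintype V] [Fintype Q] in
lemma rewire_rewire (g : Q → Equiv.Perm V) (c : Q) (a b b' : V) (h : g c a = b') :
    rewire (rewire g c a b) c a b' = g := by
  subst h
  simp only [rewire, Function.update_self, Function.update_idem]
  rw [Equiv.Perm.coe_mul, Function.comp_apply, Equiv.swap_apply_left, ← mul_assoc,
    Equiv.swap_comm b, Equiv.swap_mul_self, one_mul, Function.update_eq_self]

/-- One redirection to `b` maps the tuples that satisfy the earlier constraints onto those that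
satisfy the new one as well, and all fibres have the same size: the former end of the edge may
be any vertex that is not the prescribed end of an edge of the same label. -/
lemma sum_rewire {M : Type*} [AddCommMonoid M]
    (F : (Q → Equiv.Perm V) → M) (x y : ℕ → V) (q : ℕ → Q) (i : ℕ)
    (hx : ∀ j < i, x j ≠ x i) (hy : ∀ j ≤ i, ∀ k ≤ i, y j = y k → j = k) :
    ∑ g with ∀ j < i, g (q j) (x j) = y j, F (rewire g (q i) (x i) (y i)) =
      (Fintype.card V - ((Finset.range i).filter fun j => q j = q i).card) •
        ∑ g with ∀ j < i + 1, g (q j) (x j) = y j, F g := by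
  classical
  set U : Finset V := ((Finset.range i).filter fun j => q j = q i).image y with hU
  have hUc : U.card = ((Finset.range i).filter fun j => q j = q i).card := by
    refine Finset.card_image_of_injOn fun j hj k hk e => hy j ?_ k ?_ e
    · have := Finset.mem_range.1 (Finset.mem_filter.1 hj).1
      omega
    · have := Finset.mem_range.1 (Finset.mem_filter.1 hk).1
      omega
  rw [← hUc, ← Finset.card_compl, ← Finset.sum_const, ← Finset.sum_product']
  have hUmem : ∀ j < i, q j = q i → y j ∈ U := fun j hj hq =>
    Finset.mem_image_of_mem y (Finset.mem_filter.2 ⟨Finset.mem_range.2 hj, hq⟩)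
  refine Finset.sum_bij' (fun g _ => (g (q i) (x i), rewire g (q i) (x i) (y i)))
    (fun z _ => rewire z.2 (q i) (x i) z.1) ?_ ?_ ?_ ?_ ?_
  · intro g hg
    simp only [Finset.mem_filter, Finset.mem_univ, true_and] at hg
    simp only [Finset.mem_product, Finset.mem_compl, Finset.mem_filter, Finset.mem_univ, true_and]
    refine ⟨fun hmem => ?_, fun j hj => ?_⟩
    · obtain ⟨j, hj, e⟩ := Finset.mem_image.1 hmem
      obtain ⟨hj, hqj⟩ := Finset.mem_filter.1 hj
      have hj := Finset.mem_range.1 hj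
      rw [← hg j hj, hqj] at e
      exact hx j hj ((g (q i)).injective e)
    · rcases Nat.lt_succ_iff_lt_or_eq.1 hj with hj | rfl
      · by_cases hqj : q j = q i
        · have e := hg j hj
          rw [hqj] at e ⊢
          rw [rewire_of_ne_of_ne _ _ _ _ _ _ (hx j hj), e]
          rw [e]
          intro e'
          have := hy j hj.le i le_rfl e'
          omega
        · rw [rewire_of_ne _ _ _ _ hqj, hg j hj]
      · exact rewire_self _ _ _ _
  · rintro ⟨a, g⟩ hz
    simp only [Finset.mem_product, Finset.mem_compl, Finset.mem_filter, Finset.mem_univ,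
      true_and] at hz
    obtain ⟨ha, hg⟩ := hz
    simp only [Finset.mem_filter, Finset.mem_univ, true_and]
    intro j hj
    by_cases hqj : q j = q i
    · have e := hg j (by omega)
      have hU := hUmem j hj hqj
      rw [hqj] at e ⊢
      rw [rewire_of_ne_of_ne _ _ _ _ _ _ (hx j hj), e]
      rw [e]
      rintro rfl
      exact ha hU
    · rw [rewire_of_ne _ _ _ _ hqj, hg j (by omega)]
  · intro g _
    exact rewire_rewire _ _ _ _ _ rfl
  · rintro ⟨a, g⟩ hz
    simp only [Finset.mem_product, Finset.mem_compl, Finset.mem_filter, Finset.mem_univ,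
      true_and] at hz
    simp only [rewire_self, rewire_rewire g (q i) (x i) a (y i) (hz.2 i (by omega))]
  · intro g _
    rfl

/-- The number of tuples from which the first `i` redirections lead to a given tuple that contains
the new edges. The subtraction does not truncate when `i ≤ n`, as each count is over fewer than `i`
edges. -/
def switchCount (n : ℕ) (q : ℕ → Q) (i : ℕ) : ℕ :=
  ∏ j ∈ Finset.range i, (n - ((Finset.range j).filter fun k => q k = q j).card)

/-- The switching maps the uniform distribution on all tuples to the uniform distribution on those
that contain the cycle. -/
theorem sum_switch {M : Type*} [AddCommMonoid M] (F : (Q → Equiv.Perm V) → M) {ℓ : ℕ} {x : ℕ → V}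
    (q : ℕ → Q) (hx : Function.Periodic x ℓ) (hinj : ∀ i < ℓ, ∀ j < ℓ, x i = x j → i = j) (i : ℕ)
    (hi : i ≤ ℓ) :
    ∑ g, F (switch g x q i) =
      switchCount (Fintype.card V) q i • ∑ g with ∀ j < i, g (q j) (x j) = x (j + 1), F g := by
  induction i generalizing F with
  | zero => simp [switchCount, switch]
  | succ i ih =>
    have h1 := ih (fun g => F (rewire g (q i) (x i) (x (i + 1)))) (by omega)
    simp only [switch]
    rw [h1, sum_rewire F x (fun j => x (j + 1)) q i, ← mul_smul, switchCount, switchCount,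
      Finset.prod_range_succ]
    · intro j hj e
      have := hinj j (by omega) i (by omega) e
      omega
    · intro j hj k hk e
      have := mod_eq_of_periodic_inj (by omega : 0 < ℓ) hx hinj e
      have h2 : j ≡ k [MOD ℓ] := Nat.ModEq.add_right_cancel' 1 this
      rwa [Nat.ModEq, Nat.mod_eq_of_lt (by omega), Nat.mod_eq_of_lt (by omega)] at h2

omit [Fintype Q] in
lemma descFactorial_le_switchCount (n : ℕ) (q : ℕ → Q) (i : ℕ) :
    n.descFactorial i ≤ switchCount n q i := by
  rw [Nat.descFactorial_eq_prod_range, switchCount]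
  refine Finset.prod_le_prod' fun j _ => Nat.sub_le_sub_left ?_ n
  exact (Finset.card_filter_le _ _).trans (by simp)

omit [Fintype Q] in
lemma switchCount_le (n : ℕ) (q : ℕ → Q) (i : ℕ) : switchCount n q i ≤ n ^ i := by
  rw [switchCount]
  refine (Finset.prod_le_prod' fun j _ => Nat.sub_le n _).trans (by simp)

end Uniform

end Switch

/-! ### First moment bounds -/

section Moments

variable {V Q : Type*} [Fintype V] [DecidableEq V] [Fintype Q] [DecidableEq Q]

open Classical in
/-- The sequences of `p` distinct vertices. -/
noncomputable def injTuples (V : Type*) [Fintype V] (p : ℕ) : Finset (Fin p → V) :=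
  Finset.univ.filter Function.Injective

omit [DecidableEq V] in
lemma card_injTuples (p : ℕ) : (injTuples V p).card = (Fintype.card V).descFactorial p := by
  classical
  have := Fintype.card_embedding_eq (α := Fin p) (β := V)
  rw [Fintype.card_fin] at this
  rw [← this, ← Fintype.card_congr (Equiv.subtypeInjectiveEquivEmbedding (Fin p) V),
    Fintype.card_subtype, injTuples]

omit [Fintype V] [DecidableEq V] in
lemma injective_iff_per {p : ℕ} [NeZero p] {x : Fin p → V} :
    Function.Injective x ↔ ∀ i < p, ∀ j < p, per x i = per x j → i = j := by
  constructor
  · intro h i hi j hj e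
    rw [per_of_lt x hi, per_of_lt x hj] at e
    exact Fin.mk.inj_iff.1 (h e)
  · intro h i j e
    rw [← per_fin x i, ← per_fin x j] at e
    exact Fin.ext (h i i.2 j j.2 e)

omit [Fintype V] [DecidableEq V] [Fintype Q] [DecidableEq Q] in
lemma isCycle_iff {g : Q → Equiv.Perm V} {p : ℕ} [NeZero p] {x : Fin p → V} {q : Fin p → Q} :
    IsCycle g p (per x) (per q) ↔
      Function.Injective x ∧ ∀ j < p, g (per q j) (per x j) = per x (j + 1) := by
  constructor
  · exact fun h => ⟨injective_iff_per.2 h.inj, fun j _ => h.edge j⟩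
  · rintro ⟨h1, h2⟩
    refine ⟨per_periodic x, per_periodic q, injective_iff_per.1 h1, fun i => ?_⟩
    have := h2 (i % p) (Nat.mod_lt _ (NeZero.pos p))
    rw [(per_periodic x).map_mod_nat, (per_periodic q).map_mod_nat] at this
    rw [this, ← (per_periodic x).map_mod_nat (i + 1), ← Nat.mod_add_mod,
      (per_periodic x).map_mod_nat]

/-- Sum over cycles first, and over the tuples that contain them afterwards. -/
lemma sum_cycles {M : Type*} [AddCommMonoid M] (p : ℕ) [NeZero p]
    (F : (Q → Equiv.Perm V) → (Fin p → V) × (Fin p → Q) → M) :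
    ∑ g, ∑ c ∈ cycles g p, F g c = ∑ q : Fin p → Q, ∑ x ∈ injTuples V p,
      ∑ g with ∀ j < p, g (per q j) (per x j) = per x (j + 1), F g (x, q) := by
  classical
  simp only [cycles, injTuples, Finset.sum_filter, Fintype.sum_prod_type]
  rw [Finset.sum_comm, Finset.sum_comm (s := (Finset.univ : Finset (Fin p → Q)))]
  refine Finset.sum_congr rfl fun x _ => ?_
  rw [Finset.sum_comm]
  refine Finset.sum_congr rfl fun q _ => ?_
  simp only [isCycle_iff]
  split_ifs with h <;> simp [h]

/-- The switching formula for a cycle of length `p` given by periodic sequences. -/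
lemma sum_switch_per {M : Type*} [AddCommMonoid M] (F : (Q → Equiv.Perm V) → M) {p : ℕ} [NeZero p]
    {x : Fin p → V} (hx : x ∈ injTuples V p) (q : Fin p → Q) :
    ∑ g, F (switch g (per x) (per q) p) = switchCount (Fintype.card V) (per q) p •
      ∑ g with ∀ j < p, g (per q j) (per x j) = per x (j + 1), F g := by
  refine sum_switch F (per q) (per_periodic x) (injective_iff_per.1 ?_) p le_rfl
  simpa [injTuples] using hx

/-- The mean number of rooted cycles of length `p` is at most `|Q| ^ p`. -/
theorem sum_card_cycles_le (p : ℕ) [NeZero p] :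
    ∑ g : Q → Equiv.Perm V, (cycles g p).card ≤
      Fintype.card (Q → Equiv.Perm V) * Fintype.card Q ^ p := by
  simp only [Finset.card_eq_sum_ones]
  rw [sum_cycles p fun _ _ => 1]
  have key : ∀ q : Fin p → Q, ∑ x ∈ injTuples V p, ∑ g : Q → Equiv.Perm V with
      ∀ j < p, g (per q j) (per x j) = per x (j + 1), 1 ≤ Fintype.card (Q → Equiv.Perm V) := by
    intro q
    set D := switchCount (Fintype.card V) (per q) p
    rcases Nat.eq_zero_or_pos D with hD | hD
    -- `D = 0` leaves no room for `p` distinct vertices, so that the sum over `x` is empty.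
    · have h0 : (injTuples V p).card = 0 := by
        rw [card_injTuples]
        exact Nat.le_zero.1 (hD ▸ descFactorial_le_switchCount _ _ _)
      rw [Finset.card_eq_zero.1 h0]
      simp
    · refine Nat.le_of_mul_le_mul_left ?_ hD
      rw [Finset.mul_sum]
      have : ∀ x ∈ injTuples V p, D * ∑ g : Q → Equiv.Perm V with
          ∀ j < p, g (per q j) (per x j) = per x (j + 1), 1 = Fintype.card (Q → Equiv.Perm V) := by
        intro x hx
        have := sum_switch_per (fun _ : Q → Equiv.Perm V => 1) hx q
        rw [smul_eq_mul] at this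
        rw [← this]
        simp
      rw [Finset.sum_congr rfl this, Finset.sum_const, card_injTuples, smul_eq_mul]
      exact Nat.mul_le_mul_right _ (descFactorial_le_switchCount _ _ _)
  refine (Finset.sum_le_sum fun q _ => key q).trans (le_of_eq ?_)
  simp [mul_comm]

/-- The mean number of closed walks of length `m` is bounded independently of `|V|`. -/
theorem sum_card_closedWalks_le (hQ : 1 ≤ Fintype.card Q) (m : ℕ) [NeZero m] :
    ∑ g : Q → Equiv.Perm V, (closedWalks g m).card ≤
      Fintype.card (Q → Equiv.Perm V) * (m ^ 2 * Fintype.card Q ^ (2 * m)) := by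
  calc ∑ g : Q → Equiv.Perm V, (closedWalks g m).card
    _ ≤ ∑ g : Q → Equiv.Perm V,
        m * ∑ p ∈ Finset.range m, (cycles g (p + 1)).card * Fintype.card Q ^ m :=
      Finset.sum_le_sum fun g _ => card_closedWalks_le g m
    _ = m * ∑ p ∈ Finset.range m,
        (∑ g : Q → Equiv.Perm V, (cycles g (p + 1)).card) * Fintype.card Q ^ m := by
      rw [← Finset.mul_sum, Finset.sum_comm]
      simp only [Finset.sum_mul]
    _ ≤ m * ∑ p ∈ Finset.range m,
        (Fintype.card (Q → Equiv.Perm V) * Fintype.card Q ^ m) * Fintype.card Q ^ m := by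
      gcongr with p hp
      refine (sum_card_cycles_le (p + 1)).trans ?_
      gcongr
      exact Finset.mem_range.1 hp
    _ = _ := by
      rw [Finset.sum_const, Finset.card_range, smul_eq_mul, two_mul, pow_add]
      ring

omit [Fintype V] [DecidableEq V] [Fintype Q] [DecidableEq Q] in
lemma Reach.exists_word {g : Q → Equiv.Perm V} {a b : V} {r : ℕ} [NeZero r] (h : Reach g a r b) :
    ∃ u : Fin r → Q, walk g (per u) a r = b := by
  have : ∀ r b, Reach g a r b → ∀ w0 : ℕ → Q, ∃ w : ℕ → Q, walk g w a r = b := by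
    intro r b h w0
    induction h with
    | zero => exact ⟨w0, rfl⟩
    | @step r b c _ ih =>
      obtain ⟨w, hw⟩ := ih
      refine ⟨fun i => if i < r then w i else c, ?_⟩
      rw [walk_succ, walk_congr g a (w' := w) fun i hi => by simp [hi], hw]
      simp
  have hQ : ∃ w0 : ℕ → Q, True := by
    obtain ⟨r', rfl⟩ : ∃ r', r = r' + 1 := ⟨r - 1, (Nat.sub_add_cancel (NeZero.pos r)).symm⟩
    cases h with
    | step c _ => exact ⟨fun _ => c, trivial⟩
  obtain ⟨w0, -⟩ := hQ
  obtain ⟨w, hw⟩ := this r b h w0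
  refine ⟨fun i => w i, ?_⟩
  rw [← hw]
  exact walk_congr g a fun i hi => by rw [per_of_lt _ hi]

open Classical in
/-- The sequences of `p` distinct vertices that are joined by short walks. -/
noncomputable def badTuples (g : Q → Equiv.Perm V) (K p : ℕ) [NeZero p] : Finset (Fin p → V) :=
  (injTuples V p).filter fun x => ¬ Scattered g K (per x)

omit [DecidableEq V] [DecidableEq Q] in
open Classical in
/-- For `i ≠ j` the vertex `x j` is determined by `x i` and a word. For `i = j` the vertex `x i` is
the starting point of a closed walk. -/
lemma card_reach_le (g : Q → Equiv.Perm V) (p r : ℕ) [NeZero r] (i j : Fin (p + 1)) :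
    (Finset.univ.filter fun x : Fin (p + 1) → V => Reach g (x i) r (x j)).card ≤
      Fintype.card V ^ p * (Fintype.card Q ^ r + (closedWalks g r).card) := by
  by_cases hij : i = j
  · subst hij
    have hle : (Finset.univ.filter fun x : Fin (p + 1) → V => Reach g (x i) r (x i)).card ≤
        ((Finset.univ : Finset (Fin p → V)) ×ˢ closedWalks g r).card := by
      refine Finset.card_le_card_of_forall_subsingleton
        (fun x z => z.1 = i.removeNth x ∧ x i = z.2.1) ?_ ?_
      · intro x hx
        obtain ⟨u, hu⟩ := (Finset.mem_filter.1 hx).2.exists_word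
        refine ⟨(i.removeNth x, (x i, u)), ?_, rfl, rfl⟩
        simp [mem_closedWalks, hu]
      · rintro z - x ⟨-, h1, h2⟩ x' ⟨-, h1', h2'⟩
        rw [← Fin.insertNth_self_removeNth i x, ← Fin.insertNth_self_removeNth i x', ← h1, ← h1',
          h2, h2']
    refine hle.trans ?_
    rw [Finset.card_product, Finset.card_univ, Fintype.card_fun, Fintype.card_fin]
    gcongr
    omega
  · have hle : (Finset.univ.filter fun x : Fin (p + 1) → V => Reach g (x i) r (x j)).card ≤
        (Finset.univ : Finset ((Fin p → V) × (Fin r → Q))).card := by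
      refine Finset.card_le_card_of_forall_subsingleton
        (fun x z => z.1 = j.removeNth x ∧ x j = walk g (per z.2) (x i) r) ?_ ?_
      · intro x hx
        obtain ⟨u, hu⟩ := (Finset.mem_filter.1 hx).2.exists_word
        exact ⟨(j.removeNth x, u), Finset.mem_univ _, rfl, hu.symm⟩
      · rintro z - x ⟨-, h1, h2⟩ x' ⟨-, h1', h2'⟩
        obtain ⟨k, hk⟩ := Fin.exists_succAbove_eq hij
        have e : x i = x' i := by
          have := congrFun (h1.symm.trans h1') k
          simpa [Fin.removeNth, hk] using this
        rw [← Fin.insertNth_self_removeNth j x, ← Fin.insertNth_self_removeNth j x', ← h1, ← h1',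
          h2, h2', e]
    refine hle.trans ?_
    rw [Finset.card_univ, Fintype.card_prod, Fintype.card_fun, Fintype.card_fun, Fintype.card_fin,
      Fintype.card_fin]
    gcongr
    omega

omit [DecidableEq V] [DecidableEq Q] in
lemma card_badTuples_le (g : Q → Equiv.Perm V) (K p : ℕ) :
    (badTuples g K (p + 1)).card ≤ ∑ r ∈ Finset.range K, (p + 1) ^ 2 *
      (Fintype.card V ^ p * (Fintype.card Q ^ (r + 1) + (closedWalks g (r + 1)).card)) := by
  classical
  obtain ⟨S, hS⟩ : ∃ S : ℕ → Fin (p + 1) × Fin (p + 1) → Finset (Fin (p + 1) → V),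
      ∀ r ij, S r ij = Finset.univ.filter fun x => Reach g (x ij.1) (r + 1) (x ij.2) :=
    ⟨_, fun _ _ => rfl⟩
  calc (badTuples g K (p + 1)).card
    _ ≤ ((Finset.range K).biUnion fun r => Finset.univ.biUnion fun ij => S r ij).card := by
      refine Finset.card_le_card fun x hx => ?_
      have h := (Finset.mem_filter.1 hx).2
      simp only [Scattered] at h
      push Not at h
      obtain ⟨i, j, r, hr, hrK, h⟩ := h
      simp only [Finset.mem_biUnion, Finset.mem_range, hS, Finset.mem_univ, Finset.mem_filter,
        true_and]
      refine ⟨r - 1, by omega, (Fin.ofNat (p + 1) i, Fin.ofNat (p + 1) j), ?_⟩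
      rwa [Nat.sub_add_cancel hr]
    _ ≤ ∑ r ∈ Finset.range K, ∑ ij, (S r ij).card :=
      Finset.card_biUnion_le.trans (Finset.sum_le_sum fun r _ => Finset.card_biUnion_le)
    _ ≤ ∑ r ∈ Finset.range K, ∑ _ij : Fin (p + 1) × Fin (p + 1),
        (Fintype.card V ^ p * (Fintype.card Q ^ (r + 1) + (closedWalks g (r + 1)).card)) :=
      Finset.sum_le_sum fun r _ => Finset.sum_le_sum fun ij _ => by
        rw [hS]
        exact card_reach_le g p (r + 1) _ _
    _ = _ := by
      refine Finset.sum_congr rfl fun r _ => ?_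
      rw [Finset.sum_const, Finset.card_univ, Fintype.card_prod, Fintype.card_fin, smul_eq_mul,
        sq]

/-- On average, only a fraction of order `1 / |V|` of the sequences of `p + 1` vertices are joined by
short walks. -/
theorem sum_card_badTuples_le (hQ : 1 ≤ Fintype.card Q) {K p : ℕ} (hp : p + 1 ≤ K) :
    ∑ g : Q → Equiv.Perm V, (badTuples g K (p + 1)).card ≤
      Fintype.card (Q → Equiv.Perm V) *
        (Fintype.card V ^ p * (2 * K ^ 5 * Fintype.card Q ^ (2 * K))) := by
  set Γ := Fintype.card (Q → Equiv.Perm V)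
  set n := Fintype.card V
  set d := Fintype.card Q
  calc ∑ g : Q → Equiv.Perm V, (badTuples g K (p + 1)).card
    _ ≤ ∑ g : Q → Equiv.Perm V, ∑ r ∈ Finset.range K, (p + 1) ^ 2 *
        (n ^ p * (d ^ (r + 1) + (closedWalks g (r + 1)).card)) :=
      Finset.sum_le_sum fun g _ => card_badTuples_le g K p
    _ = ∑ r ∈ Finset.range K, (p + 1) ^ 2 *
        (n ^ p * (Γ * d ^ (r + 1) + ∑ g : Q → Equiv.Perm V, (closedWalks g (r + 1)).card)) := by
      rw [Finset.sum_comm]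
      refine Finset.sum_congr rfl fun r _ => ?_
      rw [← Finset.mul_sum, ← Finset.mul_sum, Finset.sum_add_distrib, Finset.sum_const,
        Finset.card_univ, smul_eq_mul]
    _ ≤ ∑ r ∈ Finset.range K, K ^ 2 *
        (n ^ p * (Γ * (K ^ 2 * d ^ (2 * K)) + Γ * (K ^ 2 * d ^ (2 * K)))) := by
      refine Finset.sum_le_sum fun r hr => ?_
      have hr := Finset.mem_range.1 hr
      gcongr
      · calc d ^ (r + 1) ≤ 1 * d ^ (2 * K) := by
              rw [one_mul]
              exact Nat.pow_le_pow_right hQ (by omega)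
          _ ≤ _ := by
              gcongr
              exact Nat.one_le_pow _ _ (by omega)
      · refine (sum_card_closedWalks_le hQ (r + 1)).trans ?_
        gcongr <;> omega
    _ = _ := by
      rw [Finset.sum_const, Finset.card_range, smul_eq_mul]
      ring

end Moments

/-! ### The Stein identity for closed walks -/

section Stein

lemma descFactorial_ge {n : ℕ} (hn : 1 ≤ n) (p : ℕ) :
    (n : ℝ) ^ p * (1 - p ^ 2 / n) ≤ n.descFactorial p := by
  have hn0 : (0 : ℝ) < n := by exact_mod_cast hn
  rcases Nat.lt_or_ge n p with h | h
  · have : (1 : ℝ) - p ^ 2 / n ≤ 0 := by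
      rw [sub_nonpos, le_div_iff₀ hn0, one_mul]
      have h1 : (n : ℝ) ≤ p := by exact_mod_cast h.le
      have h2 : (1 : ℝ) ≤ p := by exact_mod_cast (by omega : 1 ≤ p)
      nlinarith
    exact (mul_nonpos_of_nonneg_of_nonpos (by positivity) this).trans (by positivity)
  · have h1 : ((n - p : ℕ) : ℝ) ^ p ≤ n.descFactorial p := by
      exact_mod_cast (Nat.pow_le_pow_left (by omega) p).trans (Nat.pow_sub_le_descFactorial n p)
    have hpn : (p : ℝ) / n ≤ 1 := by
      rw [div_le_one hn0]
      exact_mod_cast h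
    refine le_trans ?_ h1
    have h2 : ((n - p : ℕ) : ℝ) = n * (1 + -(p / n)) := by
      rw [Nat.cast_sub h]
      field_simp
      ring
    rw [h2, mul_pow]
    have := one_add_mul_le_pow (a := -((p : ℝ) / n)) (by linarith) p
    refine mul_le_mul_of_nonneg_left (le_trans (le_of_eq ?_) this) (by positivity)
    ring

variable {V Q : Type*} [Fintype V] [DecidableEq V] [Fintype Q] [DecidableEq Q]

omit [Fintype V] [DecidableEq V] [Fintype Q] [DecidableEq Q] in
lemma half_pow_le_switchCount {n p : ℕ} (hn : 2 * p ^ 2 ≤ n) (hn1 : 1 ≤ n) (q : ℕ → Q)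
    [DecidableEq Q] : (n : ℝ) ^ p / 2 ≤ switchCount n q p := by
  have h1 : (n.descFactorial p : ℝ) ≤ switchCount n q p := by
    exact_mod_cast descFactorial_le_switchCount n q p
  refine le_trans ?_ ((descFactorial_ge hn1 p).trans h1)
  have hn0 : (0 : ℝ) < n := by exact_mod_cast hn1
  have : (p : ℝ) ^ 2 / n ≤ 1 / 2 := by
    rw [div_le_div_iff₀ hn0 two_pos]
    have : (2 * p ^ 2 : ℝ) ≤ n := by exact_mod_cast hn
    linarith
  have h3 : (0 : ℝ) ≤ (n : ℝ) ^ p := by positivity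
  nlinarith

/-- The numbers of closed walks of the lengths `1, …, k`. -/
noncomputable def walkCounts (k : ℕ) (g : Q → Equiv.Perm V) : Fin k → ℕ :=
  fun j => (closedWalks g (j + 1)).card

/-- The contribution of a new cycle of length `p` to the numbers of closed walks. -/
def cycleShift (k p : ℕ) : Fin k → ℕ := fun j => if p ∣ j + 1 then p else 0

omit [Fintype Q] in
lemma not_mem_badTuples {g : Q → Equiv.Perm V} {K p : ℕ} [NeZero p] {x : Fin p → V}
    (hK : 1 ≤ K) (hx : x ∈ injTuples V p) (hb : x ∉ badTuples g K p) (q : Fin p → Q) :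
    Scattered g K (per x) ∧
      SwitchState g (switch g (per x) (per q) p) p (per x) (per q) p := by
  classical
  have hs : Scattered g K (per x) := by
    by_contra h
    exact hb (Finset.mem_filter.2 ⟨hx, h⟩)
  have hinj : Function.Injective x := by simpa [injTuples] using hx
  exact ⟨hs, switchState hK hs (per_periodic x) (injective_iff_per.1 hinj) p le_rfl⟩

lemma walkCounts_switch {g : Q → Equiv.Perm V} {k p : ℕ} [NeZero p] {x : Fin p → V}
    (hx : x ∈ injTuples V p) (hb : x ∉ badTuples g (k + 1) p) (q : Fin p → Q) :
    walkCounts k (switch g (per x) (per q) p) = walkCounts k g + cycleShift k p := by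
  obtain ⟨hs, hst⟩ := not_mem_badTuples (by omega) hx hb q
  have hinj : Function.Injective x := by simpa [injTuples] using hx
  ext j
  exact hst.card_closedWalks hs (NeZero.pos p) (per_periodic x) (per_periodic q)
    (injective_iff_per.1 hinj) (by omega)

/-- The error made by the switching: a bounded quantity `F x g` that vanishes when `x` is scattered
in `g`, summed over all `g` and `x` with the weight of a single switching. -/
lemma sum_switch_error_le (hQ : 1 ≤ Fintype.card Q) {K p : ℕ} (hp : p + 1 ≤ K)
    (hV : 2 * (p + 1) ^ 2 ≤ Fintype.card V)
    (q : Fin (p + 1) → Q) (b : ℝ) (hb : 0 ≤ b)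
    (F : (Fin (p + 1) → V) → (Q → Equiv.Perm V) → ℝ)
    (hF : ∀ x g, F x g ≤ b)
    (hF0 : ∀ x ∈ injTuples V (p + 1), ∀ g, x ∉ badTuples g K (p + 1) → F x g ≤ 0) :
    (switchCount (Fintype.card V) (per q) (p + 1) : ℝ)⁻¹ *
        ∑ x ∈ injTuples V (p + 1), ∑ g : Q → Equiv.Perm V, F x g ≤
      Fintype.card (Q → Equiv.Perm V) *
        (b * (4 * K ^ 5 * Fintype.card Q ^ (2 * K) / Fintype.card V)) := by
  classical
  have hn1 : 1 ≤ Fintype.card V := le_trans (by nlinarith) hV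
  have hD := half_pow_le_switchCount hV hn1 (per q)
  set D : ℝ := ((switchCount (Fintype.card V) (per q) (p + 1) : ℕ) : ℝ)
  have hn0 : (0 : ℝ) < Fintype.card V := by exact_mod_cast hn1
  have hD0 : 0 < D := lt_of_lt_of_le (by positivity) hD
  have h1 : ∑ x ∈ injTuples V (p + 1), ∑ g : Q → Equiv.Perm V, F x g ≤
      ∑ g : Q → Equiv.Perm V, ((badTuples g K (p + 1)).card : ℝ) * b := by
    rw [Finset.sum_comm]
    refine Finset.sum_le_sum fun g _ => ?_
    have : ∑ x ∈ injTuples V (p + 1), F x g ≤ ∑ x ∈ badTuples g K (p + 1), b := by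
      rw [← Finset.sum_filter_add_sum_filter_not (injTuples V (p + 1))
        (fun x => ¬ Scattered g K (per x))]
      have h2 : ∑ x ∈ (injTuples V (p + 1)).filter (fun x => ¬¬ Scattered g K (per x)), F x g ≤ 0 := by
        refine Finset.sum_nonpos fun x hx => ?_
        obtain ⟨hx, hs⟩ := Finset.mem_filter.1 hx
        exact hF0 x hx g fun hx' => hs (Finset.mem_filter.1 hx').2
      have h3 : ∑ x ∈ (injTuples V (p + 1)).filter (fun x => ¬ Scattered g K (per x)), F x g ≤
          ∑ x ∈ badTuples g K (p + 1), b := Finset.sum_le_sum fun x _ => hF x g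
      linarith
    simpa using this
  have h2 : ∑ g : Q → Equiv.Perm V, ((badTuples g K (p + 1)).card : ℝ) ≤
      Fintype.card (Q → Equiv.Perm V) *
        (Fintype.card V ^ p * (2 * K ^ 5 * Fintype.card Q ^ (2 * K))) := by
    exact_mod_cast sum_card_badTuples_le hQ hp
  rw [← Finset.sum_mul] at h1
  have h3 : D⁻¹ ≤ 2 / (Fintype.card V : ℝ) ^ (p + 1) := by
    rw [inv_le_comm₀ hD0 (by positivity), inv_div]
    exact hD
  calc D⁻¹ * ∑ x ∈ injTuples V (p + 1), ∑ g : Q → Equiv.Perm V, F x g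
    _ ≤ D⁻¹ * ((∑ g : Q → Equiv.Perm V, ((badTuples g K (p + 1)).card : ℝ)) * b) := by gcongr
    _ ≤ 2 / (Fintype.card V : ℝ) ^ (p + 1) * ((Fintype.card (Q → Equiv.Perm V) *
        (Fintype.card V ^ p * (2 * K ^ 5 * Fintype.card Q ^ (2 * K)))) * b) := by gcongr
    _ = _ := by
      field_simp
      ring

/-- Few closed walks are not just a cycle run through several times: given a cycle, a detour from it
needs a short walk between two of its vertices, which is absent before the cycle is switched in. -/
theorem sum_card_nonWraps_le (hQ : 1 ≤ Fintype.card Q) {K m : ℕ} [NeZero m] (hm : m + 1 ≤ K)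
    (hV : 2 * K ^ 2 ≤ Fintype.card V) :
    ∑ g : Q → Equiv.Perm V, ((nonWraps g m).card : ℝ) ≤
      Fintype.card (Q → Equiv.Perm V) *
        (4 * K ^ 7 * Fintype.card Q ^ (4 * K) / Fintype.card V) := by
  classical
  set Γ : ℝ := ((Fintype.card (Q → Equiv.Perm V) : ℕ) : ℝ) with hΓ
  set n : ℝ := ((Fintype.card V : ℕ) : ℝ) with hn
  set d : ℝ := ((Fintype.card Q : ℕ) : ℝ) with hd
  have hd1 : 1 ≤ d := by
    rw [hd]
    exact_mod_cast hQ
  have hcyc : ∀ p < m, ∑ g : Q → Equiv.Perm V, ∑ c ∈ cycles g (p + 1),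
      ((detours g (p + 1) m (per c.1) (per c.2)).card : ℝ) ≤
      Γ * (4 * K ^ 5 * d ^ (4 * K) / n) := by
    intro p hp
    rw [sum_cycles (p + 1) fun g c => ((detours g (p + 1) m (per c.1) (per c.2)).card : ℝ)]
    have hV' : 2 * (p + 1) ^ 2 ≤ Fintype.card V := by
      refine le_trans ?_ hV
      gcongr
      omega
    have hn1 : 1 ≤ Fintype.card V := le_trans (by nlinarith) hV'
    have hn0 : (0 : ℝ) < n := by
      rw [hn]
      exact_mod_cast hn1
    have hq : ∀ q : Fin (p + 1) → Q, ∑ x ∈ injTuples V (p + 1),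
        ∑ g with ∀ j < p + 1, g (per q j) (per x j) = per x (j + 1),
          ((detours g (p + 1) m (per x) (per q)).card : ℝ) ≤
        Γ * (d ^ m * (4 * K ^ 5 * d ^ (2 * K) / n)) := by
      intro q
      have hD := half_pow_le_switchCount hV' hn1 (per q)
      have hD0 : (0 : ℝ) < switchCount (Fintype.card V) (per q) (p + 1) :=
        lt_of_lt_of_le (by positivity) hD
      refine le_trans (le_of_eq ?_) (sum_switch_error_le hQ (K := K) (p := p) (by omega) hV' q
        (d ^ m) (by positivity)
        (fun x g => ((detours (switch g (per x) (per q) (p + 1)) (p + 1) m (per x)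
          (per q)).card : ℝ)) ?_ ?_)
      · rw [Finset.mul_sum]
        refine Finset.sum_congr rfl fun x hx => ?_
        rw [sum_switch_per (fun g => ((detours g (p + 1) m (per x) (per q)).card : ℝ)) hx q,
          nsmul_eq_mul, inv_mul_cancel_left₀ hD0.ne']
      · intro x g
        have : (detours (switch g (per x) (per q) (p + 1)) (p + 1) m (per x) (per q)).card ≤
            Fintype.card Q ^ m := by
          refine (Finset.card_le_univ _).trans ?_
          simp
        rw [hd]
        exact_mod_cast this
      · intro x hx g hb
        obtain ⟨hs, hst⟩ := not_mem_badTuples (by omega) hx hb q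
        have hinj : Function.Injective x := by simpa [injTuples] using hx
        rw [hst.detours_eq_empty hs (Nat.succ_pos p) (per_periodic x) (per_periodic q)
          (injective_iff_per.1 hinj) (by omega)]
        simp
    calc _ ≤ ∑ _q : Fin (p + 1) → Q, Γ * (d ^ m * (4 * K ^ 5 * d ^ (2 * K) / n)) :=
          Finset.sum_le_sum fun q _ => hq q
      _ = Γ * (4 * K ^ 5 * (d ^ (p + 1) * d ^ m * d ^ (2 * K)) / n) := by
        rw [Finset.sum_const, Finset.card_univ, Fintype.card_fun, Fintype.card_fin, nsmul_eq_mul]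
        push_cast
        ring
      _ ≤ _ := by
        gcongr
        rw [← pow_add, ← pow_add]
        exact pow_le_pow_right₀ hd1 (by omega)
  calc ∑ g : Q → Equiv.Perm V, ((nonWraps g m).card : ℝ)
    _ ≤ ∑ g : Q → Equiv.Perm V, (m : ℝ) * ∑ p ∈ Finset.range m, ∑ c ∈ cycles g (p + 1),
        ((detours g (p + 1) m (per c.1) (per c.2)).card : ℝ) :=
      Finset.sum_le_sum fun g _ => by exact_mod_cast card_nonWraps_le g m
    _ = (m : ℝ) * ∑ p ∈ Finset.range m, ∑ g : Q → Equiv.Perm V, ∑ c ∈ cycles g (p + 1),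
        ((detours g (p + 1) m (per c.1) (per c.2)).card : ℝ) := by
      rw [← Finset.mul_sum, Finset.sum_comm]
    _ ≤ (m : ℝ) * ∑ p ∈ Finset.range m, Γ * (4 * K ^ 5 * d ^ (4 * K) / n) := by
      gcongr with p hp
      exact hcyc p (Finset.mem_range.1 hp)
    _ = (m : ℝ) ^ 2 * (Γ * (4 * K ^ 5 * d ^ (4 * K) / n)) := by
      rw [Finset.sum_const, Finset.card_range, nsmul_eq_mul]
      ring
    _ ≤ (K : ℝ) ^ 2 * (Γ * (4 * K ^ 5 * d ^ (4 * K) / n)) := by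
      gcongr
      omega
    _ = _ := by ring

/-- Approximate Stein identity: weighting by the number of cycles of length `p + 1` amounts to
adding one such cycle. -/
theorem norm_sum_cycles_sub_le (hQ : 1 ≤ Fintype.card Q) {k p : ℕ} (hp : p < k)
    (hV : 2 * (k + 1) ^ 2 ≤ Fintype.card V) (f : (Fin k → ℕ) → ℂ) (hf : ∀ t, ‖f t‖ ≤ 1) :
    ‖∑ g : Q → Equiv.Perm V, ((cycles g (p + 1)).card : ℂ) * f (walkCounts k g) -
        (Fintype.card Q : ℂ) ^ (p + 1) *
          ∑ g : Q → Equiv.Perm V, f (walkCounts k g + cycleShift k (p + 1))‖ ≤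
      Fintype.card (Q → Equiv.Perm V) *
        (9 * (k + 1 : ℕ) ^ 7 * Fintype.card Q ^ (4 * (k + 1)) / Fintype.card V) := by
  classical
  set K := k + 1
  set Γ : ℝ := ((Fintype.card (Q → Equiv.Perm V) : ℕ) : ℝ) with hΓ
  set n : ℝ := ((Fintype.card V : ℕ) : ℝ) with hn
  set d : ℝ := ((Fintype.card Q : ℕ) : ℝ) with hd
  have hd1 : 1 ≤ d := by
    rw [hd]
    exact_mod_cast hQ
  have hV' : 2 * (p + 1) ^ 2 ≤ Fintype.card V := by
    refine le_trans ?_ hV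
    gcongr
    omega
  have hn1 : 1 ≤ Fintype.card V := le_trans (by nlinarith) hV'
  have hn0 : (0 : ℝ) < n := by
    rw [hn]
    exact_mod_cast hn1
  have hK1 : (1 : ℝ) ≤ K := by exact_mod_cast (by omega : 1 ≤ K)
  set S : ℂ := ∑ g : Q → Equiv.Perm V, f (walkCounts k g + cycleShift k (p + 1)) with hS
  have hSn : ‖S‖ ≤ Γ := by
    refine (norm_sum_le _ _).trans ?_
    refine (Finset.sum_le_sum fun g _ => hf _).trans ?_
    simp [hΓ]
  have h1 : ∑ g : Q → Equiv.Perm V, ((cycles g (p + 1)).card : ℂ) * f (walkCounts k g) =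
      ∑ q : Fin (p + 1) → Q, ∑ x ∈ injTuples V (p + 1),
        ∑ g with ∀ j < p + 1, g (per q j) (per x j) = per x (j + 1), f (walkCounts k g) := by
    rw [← sum_cycles (p + 1) fun g _ => f (walkCounts k g)]
    simp
  have h2 : (Fintype.card Q : ℂ) ^ (p + 1) * S = ∑ _q : Fin (p + 1) → Q, S := by
    simp
  rw [h1, h2, ← Finset.sum_sub_distrib]
  have hq : ∀ q : Fin (p + 1) → Q, ‖∑ x ∈ injTuples V (p + 1),
      ∑ g with ∀ j < p + 1, g (per q j) (per x j) = per x (j + 1), f (walkCounts k g) - S‖ ≤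
      Γ * (2 * (4 * K ^ 5 * d ^ (2 * K) / n)) + Γ * (K ^ 2 / n) := by
    intro q
    have hDl := half_pow_le_switchCount hV' hn1 (per q)
    have hD1 : ((Fintype.card V).descFactorial (p + 1) : ℝ) ≤
        switchCount (Fintype.card V) (per q) (p + 1) := by
      exact_mod_cast descFactorial_le_switchCount _ _ _
    have hD2 : (switchCount (Fintype.card V) (per q) (p + 1) : ℝ) ≤ n ^ (p + 1) := by
      rw [hn]
      exact_mod_cast switchCount_le _ _ _
    have hN := descFactorial_ge hn1 (p + 1)
    have hsw := fun x (hx : x ∈ injTuples V (p + 1)) =>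
      sum_switch_per (fun g => f (walkCounts k g)) hx q
    set N : ℝ := (((Fintype.card V).descFactorial (p + 1) : ℕ) : ℝ) with hNdef
    set D : ℝ := ((switchCount (Fintype.card V) (per q) (p + 1) : ℕ) : ℝ) with hDdef
    have hD0 : 0 < D := lt_of_lt_of_le (by positivity) hDl
    have hDC : (D : ℂ) ≠ 0 := by exact_mod_cast hD0.ne'
    -- The first term comes from the `x` that are not scattered, the second one from the ratio of the
    -- number `N` of choices of `x` to the number `D` of ways to undo the switching.
    have e1 : ∑ x ∈ injTuples V (p + 1),
        ∑ g with ∀ j < p + 1, g (per q j) (per x j) = per x (j + 1), f (walkCounts k g) - S =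
        (D : ℂ)⁻¹ * ∑ x ∈ injTuples V (p + 1), ∑ g : Q → Equiv.Perm V,
          (f (walkCounts k (switch g (per x) (per q) (p + 1))) -
            f (walkCounts k g + cycleShift k (p + 1))) + ((N / D - 1 : ℝ) : ℂ) * S := by
      have : ∀ x ∈ injTuples V (p + 1),
          ∑ g with ∀ j < p + 1, g (per q j) (per x j) = per x (j + 1), f (walkCounts k g) =
          (D : ℂ)⁻¹ * ∑ g : Q → Equiv.Perm V,
            f (walkCounts k (switch g (per x) (per q) (p + 1))) := by
        intro x hx
        rw [hsw x hx, nsmul_eq_mul, hDdef, Complex.ofReal_natCast, inv_mul_cancel_left₀]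
        simpa [hDdef] using hDC
      rw [Finset.sum_congr rfl this]
      simp only [Finset.sum_sub_distrib, ← hS]
      rw [Finset.sum_const, card_injTuples, nsmul_eq_mul, ← Finset.mul_sum, hNdef]
      push_cast
      ring
    have e2 : ‖(D : ℂ)⁻¹ * ∑ x ∈ injTuples V (p + 1), ∑ g : Q → Equiv.Perm V,
          (f (walkCounts k (switch g (per x) (per q) (p + 1))) -
            f (walkCounts k g + cycleShift k (p + 1)))‖ ≤
        Γ * (2 * (4 * K ^ 5 * d ^ (2 * K) / n)) := by
      rw [norm_mul, norm_inv, Complex.norm_real, Real.norm_of_nonneg hD0.le]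
      refine le_trans ?_ (sum_switch_error_le hQ (K := K) (p := p) (by omega) hV' q 2 (by norm_num)
        (fun x g => ‖f (walkCounts k (switch g (per x) (per q) (p + 1))) -
            f (walkCounts k g + cycleShift k (p + 1))‖) ?_ ?_)
      · gcongr
        refine (norm_sum_le _ _).trans ?_
        gcongr
        exact norm_sum_le _ _
      · intro x g
        refine (norm_sub_le _ _).trans ?_
        linarith [hf (walkCounts k (switch g (per x) (per q) (p + 1))),
          hf (walkCounts k g + cycleShift k (p + 1))]
      · intro x hx g hb
        rw [walkCounts_switch hx hb q, sub_self, norm_zero]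
    have e3 : ‖((N / D - 1 : ℝ) : ℂ) * S‖ ≤ Γ * (K ^ 2 / n) := by
      rw [norm_mul, Complex.norm_real, mul_comm]
      have hle : N / D ≤ 1 := (div_le_one hD0).2 hD1
      have hge : 1 - K ^ 2 / n ≤ N / D := by
        have h3 : n ^ (p + 1) * (1 - (K : ℝ) ^ 2 / n) ≤ N := by
          refine le_trans ?_ hN
          gcongr
          exact_mod_cast (by omega : p + 1 ≤ K)
        rw [le_div_iff₀ hD0]
        rcases le_total (1 - (K : ℝ) ^ 2 / n) 0 with h0 | h0
        · exact (mul_nonpos_of_nonpos_of_nonneg h0 hD0.le).trans (by positivity)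
        · refine le_trans ?_ h3
          rw [mul_comm]
          gcongr
      rw [Real.norm_of_nonpos (by linarith)]
      exact mul_le_mul hSn (by linarith) (by linarith) (by positivity)
    rw [e1]
    exact (norm_add_le _ _).trans (add_le_add e2 e3)
  refine (norm_sum_le _ _).trans ((Finset.sum_le_sum fun q _ => hq q).trans ?_)
  rw [Finset.sum_const, Finset.card_univ, Fintype.card_fun, Fintype.card_fin, nsmul_eq_mul]
  have hd2 : d ^ (p + 1) * d ^ (2 * K) ≤ d ^ (4 * K) := by
    rw [← pow_add]
    exact pow_le_pow_right₀ hd1 (by omega)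
  have hd3 : d ^ (p + 1) ≤ d ^ (4 * K) := pow_le_pow_right₀ hd1 (by omega)
  have hK5 : (K : ℝ) ^ 5 ≤ K ^ 7 := pow_le_pow_right₀ hK1 (by norm_num)
  have hK2 : (K : ℝ) ^ 2 ≤ K ^ 7 := pow_le_pow_right₀ hK1 (by norm_num)
  calc (((Fintype.card Q ^ (p + 1) : ℕ) : ℝ)) *
      (Γ * (2 * (4 * K ^ 5 * d ^ (2 * K) / n)) + Γ * (K ^ 2 / n))
    _ = Γ * ((8 * K ^ 5 * (d ^ (p + 1) * d ^ (2 * K)) + K ^ 2 * d ^ (p + 1)) / n) := by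
      push_cast
      ring
    _ ≤ Γ * ((8 * K ^ 7 * d ^ (4 * K) + K ^ 7 * d ^ (4 * K)) / n) := by gcongr
    _ = _ := by ring

end Stein

/-! ### Characteristic functions of the walk counts -/

section CharFun

/-- If `φ` nearly satisfies the differential equation of `exp ψ`, it is near `exp ψ`. -/
lemma norm_sub_exp_le {φ ψ φ' ψ' : ℝ → ℂ} {ε B : ℝ} (hφ : ∀ s, HasDerivAt φ (φ' s) s)
    (hψ : ∀ s, HasDerivAt ψ (ψ' s) s) (hφ0 : φ 0 = 1) (hψ0 : ψ 0 = 0)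
    (h : ∀ s ∈ Set.Icc (0 : ℝ) 1, ‖φ' s - ψ' s * φ s‖ ≤ ε)
    (hB : ∀ s ∈ Set.Icc (0 : ℝ) 1, -B ≤ (ψ s).re) (h1 : (ψ 1).re ≤ 0) :
    ‖φ 1 - Complex.exp (ψ 1)‖ ≤ ε * Real.exp B := by
  have hε : 0 ≤ ε := (norm_nonneg _).trans (h 0 (by simp))
  have hd : ∀ s, HasDerivAt (fun s => φ s * Complex.exp (-ψ s))
      ((φ' s - ψ' s * φ s) * Complex.exp (-ψ s)) s := by
    intro s
    exact ((hφ s).fun_mul (hψ s).fun_neg.cexp).congr_deriv (by ring)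
  have hbound := norm_image_sub_le_of_norm_deriv_le_segment_01'
    (f := fun s => φ s * Complex.exp (-ψ s)) (C := ε * Real.exp B)
    (fun s _ => (hd s).hasDerivWithinAt) (by
      intro s hs
      rw [norm_mul, Complex.norm_exp, Complex.neg_re]
      have hs' : s ∈ Set.Icc (0 : ℝ) 1 := ⟨hs.1, hs.2.le⟩
      have := hB s hs'
      gcongr
      · exact h s hs'
      · linarith)
  simp only [hφ0, hψ0, neg_zero, Complex.exp_zero, mul_one] at hbound
  have e : φ 1 - Complex.exp (ψ 1) = (φ 1 * Complex.exp (-ψ 1) - 1) * Complex.exp (ψ 1) := by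
    rw [sub_mul, mul_assoc, ← Complex.exp_add]
    simp
  rw [e, norm_mul, Complex.norm_exp]
  calc _ ≤ ε * Real.exp B * 1 := by
        gcongr
        rw [Real.exp_le_one_iff]
        exact h1
    _ = _ := mul_one _

/-- The weight of a cycle of length `p + 1` in the linear combination of the walk counts with the
coefficients `θ`, per vertex of the cycle. -/
noncomputable def cycleWeight {k : ℕ} (θ : Fin k → ℝ) (p : ℕ) : ℝ :=
  ∑ j : Fin k, if p + 1 ∣ (j : ℕ) + 1 then θ j else 0

lemma abs_cycleWeight_le {k : ℕ} (θ : Fin k → ℝ) (p : ℕ) : |cycleWeight θ p| ≤ ∑ j, |θ j| := by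
  refine (Finset.abs_sum_le_sum_abs _ _).trans (Finset.sum_le_sum fun j _ => ?_)
  split_ifs <;> simp

/-- Exchange of the sums over the lengths of the walks and over the lengths of the cycles. -/
lemma sum_mul_divisors {k : ℕ} (θ : Fin k → ℝ) (F : ℕ → ℝ) :
    ∑ j : Fin k, θ j * ∑ p ∈ Finset.range (j + 1), (if p + 1 ∣ (j : ℕ) + 1 then F p else 0) =
      ∑ p ∈ Finset.range k, cycleWeight θ p * F p := by
  have : ∀ j : Fin k, ∑ p ∈ Finset.range (j + 1), (if p + 1 ∣ (j : ℕ) + 1 then F p else 0) =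
      ∑ p ∈ Finset.range k, (if p + 1 ∣ (j : ℕ) + 1 then F p else 0) := by
    intro j
    refine Finset.sum_subset (fun p hp => ?_) (fun p _ hp => ?_)
    · have := Finset.mem_range.1 hp
      exact Finset.mem_range.2 (by omega)
    · rw [if_neg]
      intro hd
      have := Nat.le_of_dvd (Nat.succ_pos _) hd
      exact hp (Finset.mem_range.2 (by omega))
  simp only [this, cycleWeight, Finset.mul_sum, Finset.sum_mul]
  rw [Finset.sum_comm]
  refine Finset.sum_congr rfl fun p _ => Finset.sum_congr rfl fun j _ => ?_
  split_ifs <;> simp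

lemma sum_mul_cycleShift {k : ℕ} (θ : Fin k → ℝ) (p : ℕ) :
    ∑ j, θ j * (cycleShift k (p + 1) j : ℝ) = (p + 1) * cycleWeight θ p := by
  rw [cycleWeight, Finset.mul_sum]
  refine Finset.sum_congr rfl fun j _ => ?_
  simp only [cycleShift]
  split_ifs
  · push_cast
    ring
  · simp

/-- The logarithm of the characteristic function of the sums of independent Poisson variables that
arise in the limit. -/
noncomputable def poissonExponent {k : ℕ} (d : ℝ) (θ : Fin k → ℝ) (s : ℝ) : ℂ :=
  ∑ p ∈ Finset.range k, (d ^ (p + 1) / (p + 1) : ℝ) *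
    (Complex.exp ((s * ((p + 1) * cycleWeight θ p) : ℝ) * Complex.I) - 1)

lemma hasDerivAt_cexp_ofReal_mul_I (c s : ℝ) :
    HasDerivAt (fun s : ℝ => Complex.exp ((s * c : ℝ) * Complex.I))
      (c * Complex.I * Complex.exp ((s * c : ℝ) * Complex.I)) s := by
  have h1 : HasDerivAt (fun s : ℝ => ((s * c : ℝ) : ℂ) * Complex.I) (c * Complex.I) s := by
    have := ((hasDerivAt_id s).mul_const c).ofReal_comp.mul_const Complex.I
    simpa using this
  rw [mul_comm]
  exact h1.cexp

lemma hasDerivAt_poissonExponent {k : ℕ} (d : ℝ) (θ : Fin k → ℝ) (s : ℝ) :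
    HasDerivAt (poissonExponent d θ) (∑ p ∈ Finset.range k, (d : ℂ) ^ (p + 1) *
      (cycleWeight θ p * Complex.I *
        Complex.exp ((s * ((p + 1) * cycleWeight θ p) : ℝ) * Complex.I))) s := by
  refine HasDerivAt.fun_sum fun p _ => ?_
  have := ((hasDerivAt_cexp_ofReal_mul_I ((p + 1) * cycleWeight θ p) s).sub_const 1).const_mul
    (((d ^ (p + 1) / (p + 1) : ℝ)) : ℂ)
  refine this.congr_deriv ?_
  have hp : (p : ℂ) + 1 ≠ 0 := by exact_mod_cast Nat.succ_ne_zero p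
  push_cast
  field_simp

lemma poissonExponent_re {k : ℕ} (d : ℝ) (θ : Fin k → ℝ) (s : ℝ) :
    (poissonExponent d θ s).re = ∑ p ∈ Finset.range k, d ^ (p + 1) / (p + 1) *
      (Real.cos (s * ((p + 1) * cycleWeight θ p)) - 1) := by
  rw [poissonExponent, Complex.re_sum]
  refine Finset.sum_congr rfl fun p _ => ?_
  rw [Complex.re_ofReal_mul, Complex.sub_re, Complex.exp_ofReal_mul_I_re, Complex.one_re]

variable {V Q : Type*} [Fintype V] [DecidableEq V] [Fintype Q] [DecidableEq Q]

/-- The characteristic function of the linear combination with coefficients `θ` of the walk counts of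
a uniform tuple of permutations. -/
noncomputable def walkCharFun (V Q : Type*) [Fintype V] [DecidableEq V] [Fintype Q] [DecidableEq Q]
    {k : ℕ} (θ : Fin k → ℝ) (s : ℝ) : ℂ :=
  (Fintype.card (Q → Equiv.Perm V) : ℂ)⁻¹ * ∑ g : Q → Equiv.Perm V,
    Complex.exp ((s * ∑ j, θ j * walkCounts k g j : ℝ) * Complex.I)

omit [DecidableEq V] [DecidableEq Q] in
lemma sum_mul_walkCounts {k : ℕ} (θ : Fin k → ℝ) (g : Q → Equiv.Perm V) :
    ∑ j, θ j * (walkCounts k g j : ℝ) = ∑ p ∈ Finset.range k,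
      cycleWeight θ p * ((cycles g (p + 1)).card : ℝ) +
        ∑ j : Fin k, θ j * ((nonWraps g (j + 1)).card : ℝ) := by
  rw [← sum_mul_divisors, ← Finset.sum_add_distrib]
  refine Finset.sum_congr rfl fun j _ => ?_
  rw [← mul_add, walkCounts, card_closedWalks]
  push_cast
  rfl

/-- The Stein identity, as an approximate differential equation for the characteristic function. -/
lemma norm_deriv_walkCharFun_sub_le (hQ : 1 ≤ Fintype.card Q) {k : ℕ}
    (hV : 2 * (k + 1) ^ 2 ≤ Fintype.card V) (θ : Fin k → ℝ) (s : ℝ) :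
    ‖(Fintype.card (Q → Equiv.Perm V) : ℂ)⁻¹ * ∑ g : Q → Equiv.Perm V,
        (((∑ j, θ j * walkCounts k g j : ℝ) : ℂ) * Complex.I *
          Complex.exp ((s * ∑ j, θ j * walkCounts k g j : ℝ) * Complex.I)) -
      (∑ p ∈ Finset.range k, (((Fintype.card Q : ℝ) : ℂ)) ^ (p + 1) *
        (cycleWeight θ p * Complex.I *
          Complex.exp ((s * ((p + 1) * cycleWeight θ p) : ℝ) * Complex.I))) *
        walkCharFun V Q θ s‖ ≤
      (k + 1) * (∑ j, |θ j|) *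
        (9 * (k + 1 : ℕ) ^ 7 * Fintype.card Q ^ (4 * (k + 1)) / Fintype.card V) := by
  set Γ : ℝ := ((Fintype.card (Q → Equiv.Perm V) : ℕ) : ℝ) with hΓ
  set ε : ℝ := 9 * (k + 1 : ℕ) ^ 7 * Fintype.card Q ^ (4 * (k + 1)) / Fintype.card V with hε
  have hε0 : 0 ≤ ε := by positivity
  have hΓ0 : 0 < Γ := by
    rw [hΓ]
    exact_mod_cast Fintype.card_pos
  have hΓC : (Fintype.card (Q → Equiv.Perm V) : ℂ) = (Γ : ℂ) := by simp [hΓ]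
  set f : (Fin k → ℕ) → ℂ := fun t => Complex.exp ((s * ∑ j, θ j * (t j : ℝ) : ℝ) * Complex.I)
    with hf
  have hf1 : ∀ t, ‖f t‖ ≤ 1 := fun t => (Complex.norm_exp_ofReal_mul_I _).le
  have hshift : ∀ t p, f (t + cycleShift k (p + 1)) =
      Complex.exp ((s * ((p + 1) * cycleWeight θ p) : ℝ) * Complex.I) * f t := by
    intro t p
    simp only [hf]
    rw [← Complex.exp_add, ← add_mul, ← Complex.ofReal_add, ← mul_add, ← sum_mul_cycleShift,
      ← Finset.sum_add_distrib]
    congr 4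
    refine Finset.sum_congr rfl fun j _ => ?_
    simp only [Pi.add_apply]
    push_cast
    ring
  have key : (Fintype.card (Q → Equiv.Perm V) : ℂ)⁻¹ * ∑ g : Q → Equiv.Perm V,
        (((∑ j, θ j * walkCounts k g j : ℝ) : ℂ) * Complex.I * f (walkCounts k g)) -
      (∑ p ∈ Finset.range k, (((Fintype.card Q : ℝ) : ℂ)) ^ (p + 1) *
        (cycleWeight θ p * Complex.I *
          Complex.exp ((s * ((p + 1) * cycleWeight θ p) : ℝ) * Complex.I))) *
        walkCharFun V Q θ s =
      (Γ : ℂ)⁻¹ * (∑ p ∈ Finset.range k, (cycleWeight θ p * Complex.I) *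
        (∑ g : Q → Equiv.Perm V, ((cycles g (p + 1)).card : ℂ) * f (walkCounts k g) -
          (Fintype.card Q : ℂ) ^ (p + 1) *
            ∑ g : Q → Equiv.Perm V, f (walkCounts k g + cycleShift k (p + 1))) +
        ∑ j : Fin k, (θ j * Complex.I) *
          ∑ g : Q → Equiv.Perm V, ((nonWraps g (j + 1)).card : ℂ) * f (walkCounts k g)) := by
    have e1 : ∑ g : Q → Equiv.Perm V,
        (((∑ j, θ j * walkCounts k g j : ℝ) : ℂ) * Complex.I * f (walkCounts k g)) =
        ∑ p ∈ Finset.range k, (cycleWeight θ p * Complex.I) *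
          ∑ g : Q → Equiv.Perm V, ((cycles g (p + 1)).card : ℂ) * f (walkCounts k g) +
        ∑ j : Fin k, (θ j * Complex.I) *
          ∑ g : Q → Equiv.Perm V, ((nonWraps g (j + 1)).card : ℂ) * f (walkCounts k g) := by
      simp only [Finset.mul_sum]
      rw [Finset.sum_comm, Finset.sum_comm (s := (Finset.univ : Finset (Fin k))),
        ← Finset.sum_add_distrib]
      refine Finset.sum_congr rfl fun g _ => ?_
      rw [sum_mul_walkCounts]
      push_cast
      simp only [add_mul, Finset.sum_mul]
      congr 1 <;> exact Finset.sum_congr rfl fun _ _ => by ring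
    rw [e1, walkCharFun, hΓC]
    simp only [hshift, ← Finset.mul_sum, mul_sub, Finset.sum_sub_distrib, mul_add]
    have e2 : ∀ c : ℂ, (∑ p ∈ Finset.range k, (((Fintype.card Q : ℝ) : ℂ)) ^ (p + 1) *
        (cycleWeight θ p * Complex.I *
          Complex.exp ((s * ((p + 1) * cycleWeight θ p) : ℝ) * Complex.I))) * ((Γ : ℂ)⁻¹ * c) =
        (Γ : ℂ)⁻¹ * ∑ p ∈ Finset.range k, cycleWeight θ p * Complex.I *
          ((Fintype.card Q : ℂ) ^ (p + 1) *
            (Complex.exp ((s * ((p + 1) * cycleWeight θ p) : ℝ) * Complex.I) * c)) := by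
      intro c
      rw [Finset.sum_mul, Finset.mul_sum]
      refine Finset.sum_congr rfl fun p _ => ?_
      rw [Complex.ofReal_natCast]
      ring
    rw [e2]
    ring
  change ‖(Fintype.card (Q → Equiv.Perm V) : ℂ)⁻¹ * ∑ g : Q → Equiv.Perm V,
        (((∑ j, θ j * walkCounts k g j : ℝ) : ℂ) * Complex.I * f (walkCounts k g)) - _‖ ≤ _
  rw [key, norm_mul, norm_inv, Complex.norm_real, Real.norm_of_nonneg hΓ0.le,
    inv_mul_le_iff₀ hΓ0]
  refine (norm_add_le _ _).trans ?_
  have b1 : ‖∑ p ∈ Finset.range k, (cycleWeight θ p * Complex.I) *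
        (∑ g : Q → Equiv.Perm V, ((cycles g (p + 1)).card : ℂ) * f (walkCounts k g) -
          (Fintype.card Q : ℂ) ^ (p + 1) *
            ∑ g : Q → Equiv.Perm V, f (walkCounts k g + cycleShift k (p + 1)))‖ ≤
      ∑ _p ∈ Finset.range k, (∑ j, |θ j|) * (Γ * ε) := by
    refine (norm_sum_le _ _).trans (Finset.sum_le_sum fun p hp => ?_)
    rw [norm_mul, norm_mul, Complex.norm_I, mul_one, Complex.norm_real, Real.norm_eq_abs]
    exact mul_le_mul (abs_cycleWeight_le θ p)
      (norm_sum_cycles_sub_le hQ (Finset.mem_range.1 hp) hV f hf1) (norm_nonneg _)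
      (Finset.sum_nonneg fun _ _ => abs_nonneg _)
  have b2 : ‖∑ j : Fin k, (θ j * Complex.I) *
          ∑ g : Q → Equiv.Perm V, ((nonWraps g (j + 1)).card : ℂ) * f (walkCounts k g)‖ ≤
      ∑ j, |θ j| * (Γ * ε) := by
    refine (norm_sum_le _ _).trans (Finset.sum_le_sum fun j _ => ?_)
    rw [norm_mul, norm_mul, Complex.norm_I, mul_one, Complex.norm_real, Real.norm_eq_abs]
    refine mul_le_mul_of_nonneg_left ?_ (abs_nonneg _)
    calc ‖∑ g : Q → Equiv.Perm V, ((nonWraps g (j + 1)).card : ℂ) * f (walkCounts k g)‖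
      _ ≤ ∑ g : Q → Equiv.Perm V, ((nonWraps g (j + 1)).card : ℝ) := by
        refine (norm_sum_le _ _).trans (Finset.sum_le_sum fun g _ => ?_)
        rw [norm_mul, Complex.norm_natCast]
        exact mul_le_of_le_one_right (by positivity) (hf1 _)
      _ ≤ _ := sum_card_nonWraps_le (m := (j : ℕ) + 1) hQ (K := k + 1) (by omega) hV
      _ ≤ _ := by
        rw [hε]
        gcongr
        norm_num
  refine (add_le_add b1 b2).trans (le_of_eq ?_)
  rw [Finset.sum_const, Finset.card_range, nsmul_eq_mul, ← Finset.sum_mul]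
  ring

/-- The characteristic function of the walk counts is close to that of the corresponding sums of
independent Poisson variables, with an explicit error. -/
theorem norm_walkCharFun_sub_le (hQ : 1 ≤ Fintype.card Q) {k : ℕ}
    (hV : 2 * (k + 1) ^ 2 ≤ Fintype.card V) (θ : Fin k → ℝ) (B : ℝ)
    (hB : ∑ p ∈ Finset.range k,
      (Fintype.card Q : ℝ) ^ (p + 1) * ((p + 1) * cycleWeight θ p ^ 2) ≤ B) :
    ‖walkCharFun V Q θ 1 - Complex.exp (poissonExponent (Fintype.card Q) θ 1)‖ ≤
      (k + 1) * (∑ j, |θ j|) *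
        (9 * (k + 1 : ℕ) ^ 7 * Fintype.card Q ^ (4 * (k + 1)) / Fintype.card V) * Real.exp B := by
  have hre : ∀ s, (poissonExponent (Fintype.card Q) θ s).re ≤ 0 := by
    intro s
    rw [poissonExponent_re]
    refine Finset.sum_nonpos fun p _ => mul_nonpos_of_nonneg_of_nonpos (by positivity) ?_
    linarith [Real.cos_le_one (s * ((p + 1) * cycleWeight θ p))]
  refine norm_sub_exp_le (φ := walkCharFun V Q θ) (ψ := poissonExponent (Fintype.card Q) θ)
    (fun s => ?_) (fun s => hasDerivAt_poissonExponent _ θ s) ?_ ?_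
    (fun s _ => norm_deriv_walkCharFun_sub_le hQ hV θ s) ?_ (hre 1)
  · exact (HasDerivAt.fun_sum fun g _ => hasDerivAt_cexp_ofReal_mul_I _ s).const_mul _
  · have : (Fintype.card (Q → Equiv.Perm V) : ℂ) ≠ 0 := by
      exact_mod_cast Fintype.card_ne_zero
    simp [walkCharFun]
  · simp [poissonExponent]
  · intro s hs
    rw [poissonExponent_re]
    refine le_trans (neg_le_neg hB) ?_
    rw [← Finset.sum_neg_distrib]
    refine Finset.sum_le_sum fun p _ => ?_
    have hp : (0 : ℝ) < p + 1 := by positivity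
    have h1 := Real.one_sub_sq_div_two_le_cos (x := s * ((p + 1) * cycleWeight θ p))
    have h2 : s ^ 2 ≤ 1 := by
      have := hs.1
      have := hs.2
      nlinarith
    have h3 : -((p + 1) ^ 2 * cycleWeight θ p ^ 2) ≤
        Real.cos (s * ((p + 1) * cycleWeight θ p)) - 1 := by
      have : s ^ 2 * ((p + 1) ^ 2 * cycleWeight θ p ^ 2) ≤ 1 * ((p + 1) ^ 2 * cycleWeight θ p ^ 2) := by
        gcongr
      have h0 : 0 ≤ ((p : ℝ) + 1) ^ 2 * cycleWeight θ p ^ 2 := by positivity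
      nlinarith
    calc -((Fintype.card Q : ℝ) ^ (p + 1) * ((p + 1) * cycleWeight θ p ^ 2))
      _ = (Fintype.card Q : ℝ) ^ (p + 1) / (p + 1) * -((p + 1) ^ 2 * cycleWeight θ p ^ 2) := by
        field_simp
      _ ≤ _ := by gcongr

end CharFun

/-! ### Traces and random permutations -/

section Trace

instance (n : ℕ) : DiscreteMeasurableSpace (Equiv.Perm (Fin n)) := ⟨fun _ => trivial⟩

variable {V Q : Type*} [Fintype V] [DecidableEq V] [Fintype Q]

lemma sum_permMatrix_pow_apply (g : Q → Equiv.Perm V) (m : ℕ) (a b : V) :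
    ((∑ q, (g q).permMatrix ℝ) ^ (m + 1)) a b =
      ∑ u : Fin (m + 1) → Q, if walk g (per u) a (m + 1) = b then 1 else 0 := by
  have hone : ∀ a c : V, (∑ q, (g q).permMatrix ℝ) a c = ∑ q, if g q a = c then 1 else 0 := by
    intro a c
    rw [Matrix.sum_apply]
    refine Finset.sum_congr rfl fun q _ => ?_
    simp [Equiv.Perm.permMatrix, PEquiv.toMatrix_apply, eq_comm]
  induction m generalizing a with
  | zero =>
    have e0 : ((∑ q, (g q).permMatrix ℝ) ^ (0 + 1)) a b = (∑ q, (g q).permMatrix ℝ) a b := by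
      rw [zero_add, pow_one]
    rw [e0, hone]
    refine (Fintype.sum_equiv (Equiv.funUnique (Fin 1) Q) _ _ fun u => ?_).symm
    have e : walk g (per u) a (0 + 1) = g (u 0) a := by
      rw [walk_succ, walk_zero, per_of_lt u (by norm_num : 0 < 1)]
      rfl
    rw [e]
    rfl
  | succ m ih =>
    rw [pow_succ', Matrix.mul_apply]
    simp only [hone, ih]
    rw [← (Fin.consEquiv fun _ : Fin (m + 2) => Q).sum_comp, Fintype.sum_prod_type]
    simp only [Finset.sum_mul]
    rw [Finset.sum_comm]
    refine Finset.sum_congr rfl fun q _ => ?_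
    have e : ∀ u : Fin (m + 1) → Q, walk g (per (Fin.consEquiv (fun _ : Fin (m + 2) => Q) (q, u))) a
        (m + 1 + 1) = walk g (per u) (g q a) (m + 1) := by
      intro u
      rw [walk_succ']
      have e0 : per (Fin.consEquiv (fun _ : Fin (m + 2) => Q) (q, u)) 0 = q := by
        rw [per_of_lt _ (by omega)]
        rfl
      rw [e0]
      refine walk_congr g _ fun i hi => ?_
      rw [per_of_lt _ (by omega), per_of_lt _ hi]
      rfl
    simp only [e]
    rw [Finset.sum_eq_single (g q a)]
    · simp
    · intro c _ hc
      simp [hc.symm]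
    · simp

/-- The trace of the `(j + 1)`-st power counts the closed walks of length `j + 1`. -/
theorem trace_sumPermMatrix_pow {Ω : Type*} {n d : ℕ} (π : Fin d → Ω → Equiv.Perm (Fin n)) (ω : Ω)
    (j : ℕ) : ((sumPermMatrix π ω) ^ (j + 1)).trace =
      ((closedWalks (fun q => π q ω) (j + 1)).card : ℝ) := by
  rw [Matrix.trace, sumPermMatrix, closedWalks, Finset.card_filter, Fintype.sum_prod_type]
  push_cast
  refine Finset.sum_congr rfl fun a _ => ?_
  rw [Matrix.diag_apply, sum_permMatrix_pow_apply (fun q => π q ω) j a a]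

lemma aemeasurable_tuple {Ω : Type*} [MeasurableSpace Ω] {P : Measure Ω} {n d : ℕ}
    {π : Fin d → Ω → Equiv.Perm (Fin n)} (h : IsIIDUniformPerm π P) :
    AEMeasurable (fun ω q => π q ω) P :=
  aemeasurable_pi_lambda _ fun q => (h.hasLaw q).aemeasurable

/-- Expectations with respect to independent uniform permutations are averages over all tuples. -/
lemma integral_eq_average {Ω : Type*} [MeasurableSpace Ω] {P : Measure Ω}
    [IsProbabilityMeasure P] {n d : ℕ} {π : Fin d → Ω → Equiv.Perm (Fin n)}
    (h : IsIIDUniformPerm π P) (F : (Fin d → Equiv.Perm (Fin n)) → ℂ) :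
    ∫ ω, F (fun q => π q ω) ∂P =
      (Fintype.card (Fin d → Equiv.Perm (Fin n)) : ℂ)⁻¹ * ∑ g, F g := by
  have hm := aemeasurable_tuple h
  have hmap : P.map (fun ω q => π q ω) =
      Measure.pi fun _ : Fin d => uniformOn (Set.univ : Set (Equiv.Perm (Fin n))) := by
    rw [(iIndepFun_iff_map_fun_eq_pi_map fun q => (h.hasLaw q).aemeasurable).1 h.indep]
    congr 1
    ext1 q
    exact (h.hasLaw q).map_eq
  rw [← integral_map (f := F) hm .of_discrete, hmap, integral_fintype .of_finite, Finset.mul_sum]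
  refine Finset.sum_congr rfl fun g _ => ?_
  rw [Measure.real, Measure.pi_singleton]
  simp only [uniformOn_univ, Measure.count_singleton, Finset.prod_const, Finset.card_univ,
    Fintype.card_fin, Fintype.card_fun]
  rw [ENNReal.toReal_pow, ENNReal.toReal_div]
  simp

lemma integral_cexp_eq_walkCharFun {Ω : Type*} [MeasurableSpace Ω] {P : Measure Ω}
    [IsProbabilityMeasure P] {n d k : ℕ} {π : Fin d → Ω → Equiv.Perm (Fin n)}
    (h : IsIIDUniformPerm π P) (θ : Fin k → ℝ) :
    ∫ ω, Complex.exp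
      ((∑ j : Fin k, θ j * ((sumPermMatrix π ω) ^ ((j : ℕ) + 1)).trace : ℝ) * Complex.I) ∂P =
      walkCharFun (Fin n) (Fin d) θ 1 := by
  simp only [trace_sumPermMatrix_pow, walkCharFun, one_mul]
  exact integral_eq_average h
    fun g => Complex.exp ((∑ j, θ j * walkCounts k g j : ℝ) * Complex.I)

lemma aemeasurable_trace {Ω : Type*} [MeasurableSpace Ω] {P : Measure Ω} {n d : ℕ}
    {π : Fin d → Ω → Equiv.Perm (Fin n)} (h : IsIIDUniformPerm π P) (j : ℕ) :
    AEMeasurable (fun ω => ((sumPermMatrix π ω) ^ (j + 1)).trace) P := by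
  simp only [trace_sumPermMatrix_pow]
  exact (Measurable.of_discrete
    (f := fun g : Fin d → Equiv.Perm (Fin n) => ((closedWalks g (j + 1)).card : ℝ))).comp_aemeasurable
    (aemeasurable_tuple h)

end Trace

/-! ### Convergence in law through characteristic functions -/

section Levy

/-- Lévy's convergence theorem in coordinates. -/
theorem tendstoInDistribution_of_tendsto_integral_cexp {Ω : ℕ → Type*}
    [∀ n, MeasurableSpace (Ω n)] {P : ∀ n, Measure (Ω n)} [∀ n, IsProbabilityMeasure (P n)]
    {Ω' : Type*} [MeasurableSpace Ω'] {P' : Measure Ω'} [IsProbabilityMeasure P'] {k : ℕ}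
    {X : ∀ n, Ω n → Fin k → ℝ} {Z : Ω' → Fin k → ℝ} (hX : ∀ n, AEMeasurable (X n) (P n))
    (hZ : AEMeasurable Z P')
    (h : ∀ t : Fin k → ℝ, Tendsto
      (fun n => ∫ ω, Complex.exp ((∑ j, t j * X n ω j : ℝ) * Complex.I) ∂(P n)) atTop
      (nhds (∫ ω, Complex.exp ((∑ j, t j * Z ω j : ℝ) * Complex.I) ∂P'))) :
    TendstoInDistribution X atTop Z P P' := by
  have hX' : ∀ n, AEMeasurable (fun ω => WithLp.toLp 2 (X n ω)) (P n) := fun n => by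
    have := hX n
    fun_prop
  have hZ' : AEMeasurable (fun ω => WithLp.toLp 2 (Z ω)) P' := by fun_prop
  have key : TendstoInDistribution (fun n ω => WithLp.toLp 2 (X n ω)) atTop
      (fun ω => WithLp.toLp 2 (Z ω)) P P' := by
    refine ⟨hX', hZ', ProbabilityMeasure.tendsto_of_tendsto_charFun fun t => ?_⟩
    simp only [ProbabilityMeasure.coe_mk, charFun_apply]
    have e1 : ∀ n, ∫ x, Complex.exp ((inner ℝ x t : ℝ) * Complex.I)
        ∂((P n).map fun ω => WithLp.toLp 2 (X n ω)) =
        ∫ ω, Complex.exp ((∑ j, t j * X n ω j : ℝ) * Complex.I) ∂(P n) := by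
      intro n
      rw [integral_map (hX' n) (by fun_prop)]
      simp [PiLp.inner_apply]
    have e2 : ∫ x, Complex.exp ((inner ℝ x t : ℝ) * Complex.I)
        ∂(P'.map fun ω => WithLp.toLp 2 (Z ω)) =
        ∫ ω, Complex.exp ((∑ j, t j * Z ω j : ℝ) * Complex.I) ∂P' := by
      rw [integral_map hZ' (by fun_prop)]
      simp [PiLp.inner_apply]
    rw [e2]
    simp only [e1]
    exact h fun j => t j
  exact key.continuous_comp (g := WithLp.ofLp) (by fun_prop)

lemma integral_cexp_sum_of_iIndepFun {Ω' : Type*} [MeasurableSpace Ω'] {P' : Measure Ω'}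
    {k : ℕ} {Y : Fin k → Ω' → ℝ} (hY : ∀ j, AEMeasurable (Y j) P') (h : iIndepFun Y P')
    (c : Fin k → ℝ) :
    ∫ ω, Complex.exp ((∑ j, c j * Y j ω : ℝ) * Complex.I) ∂P' =
      ∏ j, charFun (P'.map (Y j)) (c j) := by
  have h1 : iIndepFun (fun j ω => c j * Y j ω) P' :=
    h.comp (fun j y => c j * y) fun j => measurable_const_mul (c j)
  have hm : ∀ j, AEMeasurable (fun ω => c j * Y j ω) P' := fun j => (hY j).const_mul (c j)
  have h2 := congrFun (h1.charFun_map_fun_sum_eq_prod hm) 1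
  rw [charFun_apply, integral_map (Finset.univ.aemeasurable_fun_sum fun j _ => hm j) (by fun_prop)]
    at h2
  simp only [Real.inner_apply, mul_one, Finset.prod_apply] at h2
  rw [h2]
  refine Finset.prod_congr rfl fun j _ => ?_
  have e : P'.map (fun ω => c j * Y j ω) = (P'.map (Y j)).map (c j * ·) := by
    rw [AEMeasurable.map_map_of_aemeasurable (by fun_prop) (hY j)]
    rfl
  rw [e, charFun_map_mul, mul_one]

end Levy

/-! ### Growing degree -/

section Growing

variable {k : ℕ}

lemma norm_cexp_sub_le {y : ℝ} (hy : |y| ≤ 1) :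
    ‖Complex.exp (y * Complex.I) - 1 - y * Complex.I + (y ^ 2 / 2 : ℝ)‖ ≤ |y| ^ 3 := by
  have hn : ‖(y : ℂ) * Complex.I‖ = |y| := by simp
  have := Complex.exp_bound (x := y * Complex.I) (by rwa [hn]) (n := 3) (by norm_num)
  rw [hn] at this
  have e : Complex.exp (y * Complex.I) - 1 - y * Complex.I + (y ^ 2 / 2 : ℝ) =
      Complex.exp (y * Complex.I) - ∑ m ∈ Finset.range 3, (y * Complex.I) ^ m / m.factorial := by
    simp only [Finset.sum_range_succ, Finset.sum_range_zero]
    push_cast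
    simp only [Nat.factorial, mul_pow, Complex.I_sq]
    push_cast
    ring
  rw [e]
  refine this.trans ?_
  have h3 : 0 ≤ |y| ^ 3 := by positivity
  norm_num [Nat.factorial]
  linarith

/-- The normalized coefficients. -/
noncomputable def scaled (t : Fin k → ℝ) (x : ℝ) : Fin k → ℝ := fun j => t j / x ^ ((j : ℕ) + 1)

lemma abs_pow_mul_cycleWeight_le (t : Fin k → ℝ) {x : ℝ} (hx : 1 ≤ x) (p : ℕ) :
    |x ^ (p + 1) * cycleWeight (scaled t x) p| ≤ ∑ j, |t j| := by
  rw [cycleWeight, Finset.mul_sum]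
  refine (Finset.abs_sum_le_sum_abs _ _).trans (Finset.sum_le_sum fun j _ => ?_)
  split_ifs with h
  · have hle := Nat.le_of_dvd (Nat.succ_pos _) h
    have hx0 : 0 < x := by linarith
    rw [scaled, abs_mul, abs_div, abs_of_pos (pow_pos hx0 _), abs_of_pos (pow_pos hx0 _),
      mul_div_left_comm]
    refine mul_le_of_le_one_right (abs_nonneg _) ?_
    rw [div_le_one (pow_pos hx0 _)]
    exact pow_le_pow_right₀ hx hle
  · simp

lemma tendsto_pow_mul_cycleWeight (t : Fin k → ℝ) {p : ℕ} (hp : p < k) :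
    Tendsto (fun x : ℝ => x ^ (p + 1) * cycleWeight (scaled t x) p) atTop (nhds (t ⟨p, hp⟩)) := by
  simp only [cycleWeight, Finset.mul_sum]
  have : ∀ j ∈ (Finset.univ : Finset (Fin k)), Tendsto
      (fun x : ℝ => x ^ (p + 1) * if p + 1 ∣ (j : ℕ) + 1 then scaled t x j else 0) atTop
      (nhds (if j = ⟨p, hp⟩ then t j else 0)) := by
    intro j _
    split_ifs with h1 h2 h2
    · subst h2
      refine (tendsto_const_nhds (x := t ⟨p, hp⟩)).congr' ?_
      filter_upwards [eventually_gt_atTop 0] with x hx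
      simp only [scaled]
      field_simp
    · have hle := Nat.le_of_dvd (Nat.succ_pos _) h1
      have hlt : p + 1 < (j : ℕ) + 1 := by
        refine lt_of_le_of_ne hle fun e => h2 (Fin.ext ?_)
        simp only
        omega
      have := (tendsto_pow_div_pow_atTop_zero (𝕜 := ℝ) hlt).const_mul (t j)
      rw [mul_zero] at this
      refine this.congr fun x => ?_
      simp only [scaled]
      ring
    · exact absurd (by rw [h2]) h1
    · simp
  have h := tendsto_finsetSum _ this
  simpa using h

/-- The means of the Poisson sums, after the centering, leave the contribution of the cycles of half
the length. -/
lemma tendsto_mean (t : Fin k → ℝ) :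
    Tendsto (fun x : ℝ => ∑ p ∈ Finset.range k, cycleWeight (scaled t x) p * (x ^ 2) ^ (p + 1) -
      ∑ j : Fin k, t j * x ^ ((j : ℕ) + 1)) atTop
      (nhds (∑ j : Fin k, t j * if Even ((j : ℕ) + 1) then 1 else 0)) := by
  have h1 : ∀ j ∈ (Finset.univ : Finset (Fin k)), Tendsto (fun x : ℝ => t j *
      ∑ p ∈ Finset.range (j : ℕ), if p + 1 ∣ (j : ℕ) + 1 then
        (x ^ 2) ^ (p + 1) / x ^ ((j : ℕ) + 1) else 0) atTop
      (nhds (t j * if Even ((j : ℕ) + 1) then 1 else 0)) := by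
    intro j _
    refine Tendsto.const_mul _ ?_
    have h2 : ∀ p ∈ Finset.range (j : ℕ), Tendsto (fun x : ℝ => if p + 1 ∣ (j : ℕ) + 1 then
        (x ^ 2) ^ (p + 1) / x ^ ((j : ℕ) + 1) else 0) atTop
        (nhds (if 2 * (p + 1) = (j : ℕ) + 1 then 1 else 0)) := by
      intro p hp
      have hp := Finset.mem_range.1 hp
      simp only [← pow_mul]
      by_cases h3 : 2 * (p + 1) = (j : ℕ) + 1
      · rw [if_pos h3]
        refine (tendsto_const_nhds (x := (1 : ℝ))).congr' ?_
        filter_upwards [eventually_gt_atTop 0] with x hx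
        rw [if_pos ⟨2, by omega⟩, h3, div_self (pow_pos hx _).ne']
      · rw [if_neg h3]
        split_ifs with h4
        · refine tendsto_pow_div_pow_atTop_zero ?_
          obtain ⟨c, hc⟩ := h4
          rcases c with _ | _ | _ | c
          · omega
          · omega
          · omega
          · rw [hc]
            nlinarith
        · exact tendsto_const_nhds
    have h5 := tendsto_finsetSum _ h2
    convert h5 using 2
    split_ifs with he
    · obtain ⟨r, hr⟩ := he
      rw [Finset.sum_eq_single (r - 1)]
      · rw [if_pos (by omega)]
      · intro p _ hp
        rw [if_neg (by omega)]
      · intro h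
        exact absurd (Finset.mem_range.2 (by omega)) h
    · symm
      refine Finset.sum_eq_zero fun p _ => ?_
      rw [if_neg]
      intro h
      exact he ⟨p + 1, by omega⟩
  refine (tendsto_finsetSum _ h1).congr' ?_
  filter_upwards [eventually_gt_atTop 0] with x hx
  rw [← sum_mul_divisors, ← Finset.sum_sub_distrib]
  refine Finset.sum_congr rfl fun j _ => ?_
  rw [Finset.sum_range_succ, if_pos dvd_rfl, mul_add, add_sub_assoc]
  have e : scaled t x j * (x ^ 2) ^ ((j : ℕ) + 1) - t j * x ^ ((j : ℕ) + 1) = 0 := by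
    simp only [scaled]
    field_simp
    ring
  rw [e, add_zero, Finset.mul_sum, Finset.mul_sum]
  refine Finset.sum_congr rfl fun p _ => ?_
  split_ifs
  · simp only [scaled]
    ring
  · simp

/-- The Poisson exponent of the normalized coefficients, centered, converges to the Gaussian one. -/
theorem tendsto_poissonExponent (t : Fin k → ℝ) :
    Tendsto (fun x : ℝ => poissonExponent (x ^ 2) (scaled t x) 1 -
      (∑ j : Fin k, t j * x ^ ((j : ℕ) + 1) : ℝ) * Complex.I) atTop
      (nhds ((∑ j : Fin k, t j * if Even ((j : ℕ) + 1) then 1 else 0 : ℝ) * Complex.I -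
        (∑ j : Fin k, ((j : ℕ) + 1) * t j ^ 2 / 2 : ℝ))) := by
  -- Taylor expansion of the exponentials to the second order
  have hrem : ∀ p ∈ Finset.range k, Tendsto (fun x : ℝ =>
      (((x ^ 2) ^ (p + 1) / (p + 1) : ℝ) : ℂ) *
        (Complex.exp (((p + 1) * cycleWeight (scaled t x) p : ℝ) * Complex.I) - 1 -
          ((p + 1) * cycleWeight (scaled t x) p : ℝ) * Complex.I +
          (((p + 1) * cycleWeight (scaled t x) p) ^ 2 / 2 : ℝ))) atTop (nhds 0) := by
    intro p hp
    have hw := tendsto_pow_mul_cycleWeight t (Finset.mem_range.1 hp)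
    have hinv : Tendsto (fun x : ℝ => (x ^ (p + 1))⁻¹) atTop (nhds 0) :=
      (tendsto_pow_atTop (Nat.succ_ne_zero p)).inv_tendsto_atTop
    have hy : Tendsto (fun x : ℝ => (p + 1) * cycleWeight (scaled t x) p) atTop (nhds 0) := by
      have := (hw.mul hinv).const_mul ((p : ℝ) + 1)
      rw [mul_zero, mul_zero] at this
      refine this.congr' ?_
      filter_upwards [eventually_gt_atTop 0] with x hx
      field_simp
    have hbd : Tendsto (fun x : ℝ => ((p : ℝ) + 1) ^ 2 *
        (|x ^ (p + 1) * cycleWeight (scaled t x) p| ^ 3 * (x ^ (p + 1))⁻¹)) atTop (nhds 0) := by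
      have := ((hw.abs.pow 3).mul hinv).const_mul (((p : ℝ) + 1) ^ 2)
      rwa [mul_zero, mul_zero] at this
    refine squeeze_zero_norm' ?_ hbd
    have hy1 : ∀ᶠ x : ℝ in atTop, |(p + 1) * cycleWeight (scaled t x) p| ≤ 1 := by
      have := hy.abs
      rw [abs_zero] at this
      exact this.eventually_le_const one_pos
    filter_upwards [hy1, eventually_gt_atTop 0] with x hx hx0
    rw [norm_mul, Complex.norm_real, Real.norm_of_nonneg (by positivity)]
    refine (mul_le_mul_of_nonneg_left (norm_cexp_sub_le hx) (by positivity)).trans (le_of_eq ?_)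
    rw [abs_mul, abs_mul, abs_of_pos (by positivity : (0 : ℝ) < p + 1),
      abs_of_pos (pow_pos hx0 _)]
    field_simp
    ring
  have hvar : Tendsto (fun x : ℝ => ∑ p ∈ Finset.range k,
      ((p : ℝ) + 1) * (x ^ (p + 1) * cycleWeight (scaled t x) p) ^ 2 / 2) atTop
      (nhds (∑ j : Fin k, ((j : ℕ) + 1) * t j ^ 2 / 2)) := by
    simp only [Finset.sum_range]
    exact tendsto_finsetSum _ fun p _ =>
      (((tendsto_pow_mul_cycleWeight t p.2).pow 2).const_mul _).div_const 2
  have hmean := tendsto_mean t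
  have hall := ((tendsto_finsetSum _ hrem).add
    ((Complex.continuous_ofReal.tendsto _).comp hmean |>.mul_const Complex.I)).sub
    ((Complex.continuous_ofReal.tendsto _).comp hvar)
  simp only [Finset.sum_const_zero, zero_add] at hall
  refine hall.congr fun x => ?_
  simp only [Function.comp_apply, poissonExponent, one_mul]
  push_cast
  rw [sub_mul, Finset.sum_mul, ← add_sub_assoc, ← Finset.sum_add_distrib, sub_right_comm,
    ← Finset.sum_sub_distrib]
  congr 1
  refine Finset.sum_congr rfl fun p _ => ?_
  have hp : (p : ℂ) + 1 ≠ 0 := by exact_mod_cast Nat.succ_ne_zero p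
  field_simp
  ring

lemma tendsto_pow_div_of_isLittleO_log {d : ℕ → ℕ} (hd : Tendsto d atTop atTop)
    (h : (fun n : ℕ => Real.log (d n : ℝ)) =o[atTop] (fun n : ℕ => Real.log (n : ℝ))) (C : ℕ) :
    Tendsto (fun n : ℕ => (d n : ℝ) ^ C / n) atTop (nhds 0) := by
  have hlim : Tendsto (fun n : ℕ => (Real.sqrt n)⁻¹) atTop (nhds 0) :=
    (Real.tendsto_sqrt_atTop.comp tendsto_natCast_atTop_atTop).inv_tendsto_atTop
  refine squeeze_zero' (Eventually.of_forall fun n => by positivity) ?_ hlim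
  have hc : (0 : ℝ) < 1 / (2 * (C + 1)) := by positivity
  filter_upwards [h.bound hc, hd.eventually_ge_atTop 1, eventually_ge_atTop 1] with n h1 h2 h3
  have hn : (0 : ℝ) < n := by exact_mod_cast h3
  have hdn : (0 : ℝ) < d n := by exact_mod_cast h2
  have hln : 0 ≤ Real.log n := Real.log_nonneg (by exact_mod_cast h3)
  have hld : 0 ≤ Real.log (d n) := Real.log_nonneg (by exact_mod_cast h2)
  rw [Real.norm_of_nonneg hln, Real.norm_of_nonneg hld] at h1
  have h4 : C * Real.log (d n) ≤ Real.log n / 2 := by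
    have e : ((C : ℝ) + 1) * (1 / (2 * (C + 1)) * Real.log n) = Real.log n / 2 := by field_simp
    calc C * Real.log (d n) ≤ (C + 1) * Real.log (d n) := by nlinarith
      _ ≤ (C + 1) * (1 / (2 * (C + 1)) * Real.log n) := by gcongr
      _ = _ := e
  have h5 : (d n : ℝ) ^ C ≤ Real.sqrt n := by
    rw [← Real.log_le_log_iff (by positivity) (by positivity), Real.log_pow,
      Real.log_sqrt hn.le]
    exact h4
  rw [div_le_iff₀ hn]
  have : (Real.sqrt n)⁻¹ * n = Real.sqrt n := by
    have := Real.sqrt_pos.2 hn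
    field_simp
    rw [Real.sq_sqrt hn.le]
  rwa [this]

end Growing

/-! ### The two limit theorems -/

section Limits

lemma iIndepFun_fin {Ω' : Type*} [MeasurableSpace Ω'] {P' : Measure Ω'} {E : Type*}
    [MeasurableSpace E] {Y : ℕ → Ω' → E} (h : iIndepFun (fun ℓ : Set.Ici (1 : ℕ) => Y ℓ) P')
    (k : ℕ) : iIndepFun (fun p : Fin k => Y (p + 1)) P' := by
  have hinj : Function.Injective
      (fun p : Fin k => (⟨(p : ℕ) + 1, Nat.succ_pos _⟩ : Set.Ici (1 : ℕ))) := by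
    intro p p' e
    have := congrArg Subtype.val e
    exact Fin.ext (by simpa using this)
  exact h.precomp hinj

lemma sum_divisors_succ (F : ℕ → ℝ) (j : ℕ) :
    ∑ ℓ ∈ Nat.divisors (j + 1), F ℓ =
      ∑ p ∈ Finset.range (j + 1), if p + 1 ∣ j + 1 then F (p + 1) else 0 := by
  rw [Nat.divisors, Finset.sum_filter, Finset.sum_Ico_eq_sum_range]
  refine Finset.sum_congr (by simp) fun p _ => ?_
  rw [add_comm 1 p]

/-- The characteristic function of the sums `∑ ℓ ∣ j, ℓ Λ ℓ`. -/
lemma integral_cexp_poisson {Ω' : Type*} [MeasurableSpace Ω'] {P' : Measure Ω'}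
    {d : ℕ} {Λ : ℕ → Ω' → ℕ}
    (hΛ : ∀ ℓ : ℕ, 1 ≤ ℓ → HasLaw (Λ ℓ) (poissonMeasure ((d : ℝ≥0) ^ ℓ / (ℓ : ℝ≥0))) P')
    (hind : iIndepFun (fun ℓ : Set.Ici (1 : ℕ) => Λ ℓ) P') {k : ℕ} (t : Fin k → ℝ) :
    ∫ ω, Complex.exp ((∑ j : Fin k, t j * ∑ ℓ ∈ Nat.divisors ((j : ℕ) + 1),
      (ℓ : ℝ) * (Λ ℓ ω : ℝ) : ℝ) * Complex.I) ∂P' = Complex.exp (poissonExponent d t 1) := by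
  have hY : ∀ p : Fin k, AEMeasurable (fun ω => (Λ (p + 1) ω : ℝ)) P' := fun p =>
    (Measurable.of_discrete (f := fun n : ℕ => (n : ℝ))).comp_aemeasurable
      (hΛ (p + 1) (Nat.succ_pos _)).aemeasurable
  have hindY : iIndepFun (fun (p : Fin k) ω => (Λ (p + 1) ω : ℝ)) P' :=
    (iIndepFun_fin hind k).comp (fun _ n => (n : ℝ)) fun _ => Measurable.of_discrete
  have e1 : ∀ ω, ∑ j : Fin k, t j * ∑ ℓ ∈ Nat.divisors ((j : ℕ) + 1), (ℓ : ℝ) * (Λ ℓ ω : ℝ) =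
      ∑ p : Fin k, ((p + 1) * cycleWeight t p) * (Λ (p + 1) ω : ℝ) := by
    intro ω
    have e2 : ∀ j : ℕ, ∑ ℓ ∈ Nat.divisors (j + 1), (ℓ : ℝ) * (Λ ℓ ω : ℝ) =
        ∑ p ∈ Finset.range (j + 1), if p + 1 ∣ j + 1 then ((p + 1 : ℕ) : ℝ) * (Λ (p + 1) ω : ℝ)
          else 0 := fun j => sum_divisors_succ (fun ℓ => (ℓ : ℝ) * (Λ ℓ ω : ℝ)) j
    simp only [e2]
    rw [sum_mul_divisors t fun p => ((p + 1 : ℕ) : ℝ) * (Λ (p + 1) ω : ℝ), Finset.sum_range]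
    refine Finset.sum_congr rfl fun p _ => ?_
    push_cast
    ring
  simp only [e1]
  rw [integral_cexp_sum_of_iIndepFun hY hindY, poissonExponent, Complex.exp_sum, Finset.prod_range]
  refine Finset.prod_congr rfl fun p _ => ?_
  have e3 : P'.map (fun ω => (Λ (p + 1) ω : ℝ)) =
      (poissonMeasure ((d : ℝ≥0) ^ ((p : ℕ) + 1) / (((p : ℕ) + 1 : ℕ) : ℝ≥0))).map (Nat.cast) := by
    rw [← (hΛ (p + 1) (Nat.succ_pos _)).map_eq, AEMeasurable.map_map_of_aemeasurable
      (by fun_prop) (hΛ (p + 1) (Nat.succ_pos _)).aemeasurable]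
    rfl
  rw [e3, charFun_map_cast_poissonMeasure]
  push_cast
  simp

/-- The characteristic function of the Gaussian limit. -/
lemma integral_cexp_gaussian {Ω' : Type*} [MeasurableSpace Ω'] {P' : Measure Ω'}
    {N : ℕ → Ω' → ℝ} (hN : ∀ ℓ : ℕ, 1 ≤ ℓ → HasLaw (N ℓ) (gaussianReal 0 1) P')
    (hind : iIndepFun (fun ℓ : Set.Ici (1 : ℕ) => N ℓ) P') {k : ℕ} (t : Fin k → ℝ) :
    ∫ ω, Complex.exp ((∑ j : Fin k, t j * (Real.sqrt (((j : ℕ) + 1 : ℕ) : ℝ) * N ((j : ℕ) + 1) ω +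
      if Even ((j : ℕ) + 1) then 1 else 0) : ℝ) * Complex.I) ∂P' =
      Complex.exp ((∑ j : Fin k, t j * if Even ((j : ℕ) + 1) then 1 else 0 : ℝ) * Complex.I -
        (∑ j : Fin k, ((j : ℕ) + 1) * t j ^ 2 / 2 : ℝ)) := by
  have e1 : ∀ ω, Complex.exp ((∑ j : Fin k, t j * (Real.sqrt (((j : ℕ) + 1 : ℕ) : ℝ) *
      N ((j : ℕ) + 1) ω + if Even ((j : ℕ) + 1) then 1 else 0) : ℝ) * Complex.I) =
      Complex.exp ((∑ j : Fin k, t j * if Even ((j : ℕ) + 1) then 1 else 0 : ℝ) * Complex.I) *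
      Complex.exp ((∑ j : Fin k, (t j * Real.sqrt (((j : ℕ) + 1 : ℕ) : ℝ)) * N ((j : ℕ) + 1) ω : ℝ) *
        Complex.I) := by
    intro ω
    rw [← Complex.exp_add, ← add_mul, ← Complex.ofReal_add, ← Finset.sum_add_distrib]
    congr 3
    exact Finset.sum_congr rfl fun j _ => by ring
  simp only [e1]
  rw [integral_const_mul, integral_cexp_sum_of_iIndepFun
    (fun j => (hN (j + 1) (Nat.succ_pos _)).aemeasurable) (iIndepFun_fin hind k), sub_eq_add_neg,
    Complex.exp_add]
  congr 1
  rw [← Complex.ofReal_neg, ← Finset.sum_neg_distrib, Complex.ofReal_sum, Complex.exp_sum]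
  refine Finset.prod_congr rfl fun j _ => ?_
  rw [(hN (j + 1) (Nat.succ_pos _)).map_eq, charFun_gaussianReal]
  congr 1
  have hs : ((Real.sqrt (((j : ℕ) + 1 : ℕ) : ℝ) : ℝ) : ℂ) ^ 2 = (j : ℂ) + 1 := by
    rw [← Complex.ofReal_pow, Real.sq_sqrt (by positivity)]
    push_cast
    rfl
  push_cast at hs ⊢
  rw [mul_pow, hs]
  ring

/-- For uniformly bounded coefficients and `d(n) = n ^ o(1)`, the characteristic functions of the
walk counts and of the Poisson sums have the same limits. -/
lemma tendsto_walkCharFun_sub {k : ℕ} {d : ℕ → ℕ} (hd1 : ∀ᶠ n in atTop, 1 ≤ d n)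
    (hd : Tendsto (fun n : ℕ => (d n : ℝ) ^ (4 * (k + 1)) / n) atTop (nhds 0))
    (θ : ℕ → Fin k → ℝ) (S B : ℝ) (hS : ∀ᶠ n in atTop, ∑ j, |θ n j| ≤ S)
    (hB : ∀ᶠ n in atTop, ∑ p ∈ Finset.range k,
      (d n : ℝ) ^ (p + 1) * ((p + 1) * cycleWeight (θ n) p ^ 2) ≤ B) :
    Tendsto (fun n => walkCharFun (Fin n) (Fin (d n)) (θ n) 1 -
      Complex.exp (poissonExponent (d n) (θ n) 1)) atTop (nhds 0) := by
  have hlim := hd.const_mul ((k + 1) * S * (9 * ((k + 1 : ℕ) : ℝ) ^ 7) * Real.exp B)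
  rw [mul_zero] at hlim
  refine squeeze_zero_norm' ?_ hlim
  filter_upwards [hd1, hS, hB, eventually_ge_atTop (2 * (k + 1) ^ 2)] with n h1 h2 h3 h4
  have := norm_walkCharFun_sub_le (V := Fin n) (Q := Fin (d n)) (by simpa using h1)
    (by simpa using h4) (θ n) B (by simpa using h3)
  simp only [Fintype.card_fin] at this
  refine this.trans ?_
  calc _ ≤ ((k : ℝ) + 1) * S * (9 * ((k + 1 : ℕ) : ℝ) ^ 7 * (d n : ℝ) ^ (4 * (k + 1)) / n) *
        Real.exp B := by gcongr
    _ = _ := by ring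

variable {Ω : ℕ → Type*} [∀ n, MeasurableSpace (Ω n)] (P : ∀ n, Measure (Ω n))
  [∀ n, IsProbabilityMeasure (P n)] {Ω' : Type*} [MeasurableSpace Ω'] (P' : Measure Ω')
  [IsProbabilityMeasure P']

theorem tendstoInDistribution_trace_of_const (d : ℕ) (hd : 0 < d)
    (π : ∀ n, Fin d → Ω n → Equiv.Perm (Fin n)) (hπ : ∀ n, IsIIDUniformPerm (π n) (P n))
    (Λ : ℕ → Ω' → ℕ)
    (hΛ : ∀ ℓ : ℕ, 1 ≤ ℓ → HasLaw (Λ ℓ) (poissonMeasure ((d : ℝ≥0) ^ ℓ / (ℓ : ℝ≥0))) P')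
    (hind : iIndepFun (fun ℓ : Set.Ici (1 : ℕ) => Λ ℓ) P') (k : ℕ) :
    TendstoInDistribution
      (fun (n : ℕ) (ω : Ω n) (j : Fin k) => ((sumPermMatrix (π n) ω) ^ ((j : ℕ) + 1)).trace)
      atTop
      (fun (ω : Ω') (j : Fin k) =>
        ∑ ℓ ∈ Nat.divisors ((j : ℕ) + 1), (ℓ : ℝ) * (Λ ℓ ω : ℝ))
      P P' := by
  refine tendstoInDistribution_of_tendsto_integral_cexp
    (fun n => aemeasurable_pi_lambda _ fun j => aemeasurable_trace (hπ n) j) ?_ fun t => ?_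
  · refine aemeasurable_pi_lambda _ fun j => Finset.aemeasurable_fun_sum _ fun ℓ hℓ => ?_
    exact ((Measurable.of_discrete (f := fun n : ℕ => (n : ℝ))).comp_aemeasurable
      (hΛ ℓ (Nat.pos_of_mem_divisors hℓ)).aemeasurable).const_mul _
  · rw [integral_cexp_poisson hΛ hind t]
    simp only [integral_cexp_eq_walkCharFun (hπ _) t]
    have := tendsto_walkCharFun_sub (k := k) (d := fun _ => d) (Eventually.of_forall fun _ => hd)
      (tendsto_const_nhds.div_atTop tendsto_natCast_atTop_atTop) (fun _ => t) _ _
      (Eventually.of_forall fun _ => le_rfl) (Eventually.of_forall fun _ => le_rfl)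
    simpa using this.add_const (Complex.exp (poissonExponent d t 1))

theorem tendstoInDistribution_trace_of_growing (d : ℕ → ℕ) (hd : Tendsto d atTop atTop)
    (hlog : (fun n : ℕ => Real.log (d n : ℝ)) =o[atTop] (fun n : ℕ => Real.log (n : ℝ)))
    (π : ∀ n, Fin (d n) → Ω n → Equiv.Perm (Fin n)) (hπ : ∀ n, IsIIDUniformPerm (π n) (P n))
    (N : ℕ → Ω' → ℝ) (hN : ∀ ℓ : ℕ, 1 ≤ ℓ → HasLaw (N ℓ) (gaussianReal 0 1) P')
    (hind : iIndepFun (fun ℓ : Set.Ici (1 : ℕ) => N ℓ) P') (k : ℕ) :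
    TendstoInDistribution
      (fun (n : ℕ) (ω : Ω n) (j : Fin k) =>
        (((sumPermMatrix (π n) ω) ^ ((j : ℕ) + 1)).trace - (d n : ℝ) ^ ((j : ℕ) + 1)) /
          Real.sqrt ((d n : ℝ) ^ ((j : ℕ) + 1)))
      atTop
      (fun (ω : Ω') (j : Fin k) =>
        Real.sqrt (((j : ℕ) + 1 : ℕ) : ℝ) * N ((j : ℕ) + 1) ω +
          if Even ((j : ℕ) + 1) then 1 else 0)
      P P' := by
  refine tendstoInDistribution_of_tendsto_integral_cexp
    (fun n => aemeasurable_pi_lambda _ fun j =>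
      ((aemeasurable_trace (hπ n) j).sub_const _).div_const _) ?_ fun t => ?_
  · exact aemeasurable_pi_lambda _ fun j =>
      ((hN _ (Nat.succ_pos _)).aemeasurable.const_mul _).add_const _
  rw [integral_cexp_gaussian hN hind t]
  set x : ℕ → ℝ := fun n => Real.sqrt (d n) with hx
  have hx2 : ∀ n, x n ^ 2 = d n := fun n => Real.sq_sqrt (Nat.cast_nonneg _)
  have hsqrt : ∀ n m, Real.sqrt ((d n : ℝ) ^ m) = x n ^ m := by
    intro n m
    rw [← hx2, ← pow_mul, mul_comm, pow_mul, Real.sqrt_sq (pow_nonneg (Real.sqrt_nonneg _) _)]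
  have hxlim : Tendsto x atTop atTop :=
    Real.tendsto_sqrt_atTop.comp (tendsto_natCast_atTop_atTop.comp hd)
  have hx1 : ∀ᶠ n in atTop, 1 ≤ x n := hxlim.eventually_ge_atTop 1
  have hscaled : ∀ n, 1 ≤ x n → ∫ ω, Complex.exp ((∑ j : Fin k, t j *
      ((((sumPermMatrix (π n) ω) ^ ((j : ℕ) + 1)).trace - (d n : ℝ) ^ ((j : ℕ) + 1)) /
          Real.sqrt ((d n : ℝ) ^ ((j : ℕ) + 1))) : ℝ) * Complex.I) ∂(P n) =
      Complex.exp (-((∑ j : Fin k, t j * x n ^ ((j : ℕ) + 1) : ℝ) * Complex.I)) *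
        walkCharFun (Fin n) (Fin (d n)) (scaled t (x n)) 1 := by
    intro n hn
    rw [← integral_cexp_eq_walkCharFun (hπ n), ← integral_const_mul]
    refine integral_congr_ae (Eventually.of_forall fun ω => ?_)
    simp only
    rw [← Complex.exp_add, ← neg_mul, ← add_mul, ← Complex.ofReal_neg, ← Complex.ofReal_add,
      ← Finset.sum_neg_distrib, ← Finset.sum_add_distrib]
    congr 3
    refine Finset.sum_congr rfl fun j _ => ?_
    have hpos : 0 < x n := by linarith
    rw [hsqrt, ← hx2, scaled]
    field_simp
    ring
  have hdiff := tendsto_walkCharFun_sub (k := k) (d := d) (hd.eventually_ge_atTop 1)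
    (tendsto_pow_div_of_isLittleO_log hd hlog _) (fun n => scaled t (x n)) (∑ j, |t j|)
    (∑ p ∈ Finset.range k, ((p : ℝ) + 1) * (∑ j, |t j|) ^ 2) (by
      filter_upwards [hx1] with n hn
      refine Finset.sum_le_sum fun j _ => ?_
      rw [scaled, abs_div]
      exact div_le_self (abs_nonneg _) ((one_le_pow₀ hn).trans (le_abs_self _))) (by
      filter_upwards [hx1] with n hn
      refine Finset.sum_le_sum fun p _ => ?_
      have h1 := abs_pow_mul_cycleWeight_le t hn p
      calc (d n : ℝ) ^ (p + 1) * ((p + 1) * cycleWeight (scaled t (x n)) p ^ 2)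
        _ = (p + 1) * |x n ^ (p + 1) * cycleWeight (scaled t (x n)) p| ^ 2 := by
          rw [← hx2, sq_abs]
          ring
        _ ≤ _ := by gcongr)
  have hmain := (Complex.continuous_exp.tendsto _).comp ((tendsto_poissonExponent t).comp hxlim)
  have hsmall : Tendsto (fun n =>
      Complex.exp (-((∑ j : Fin k, t j * x n ^ ((j : ℕ) + 1) : ℝ) * Complex.I)) *
        (walkCharFun (Fin n) (Fin (d n)) (scaled t (x n)) 1 -
          Complex.exp (poissonExponent (d n) (scaled t (x n)) 1))) atTop (nhds 0) := by
    refine squeeze_zero_norm (fun n => ?_) (tendsto_zero_iff_norm_tendsto_zero.1 hdiff)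
    rw [norm_mul, ← neg_mul, ← Complex.ofReal_neg, Complex.norm_exp_ofReal_mul_I, one_mul]
  have := hsmall.add hmain
  rw [zero_add] at this
  refine this.congr' ?_
  filter_upwards [hx1] with n hn
  rw [hscaled n hn]
  simp only [Function.comp_apply]
  rw [hx2, mul_sub, ← Complex.exp_add]
  rw [sub_eq_add_neg (poissonExponent _ _ _), add_comm (poissonExponent _ _ _)]
  ring

end Limits

end PermWalk
theorem mainTheorem5
    {Ω : ℕ → Type*} [∀ n, MeasurableSpace (Ω n)] (P : ∀ n, Measure (Ω n))
    [∀ n, IsProbabilityMeasure (P n)]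
    {Ω' : Type*} [MeasurableSpace Ω'] (P' : Measure Ω') [IsProbabilityMeasure P'] :
    -- (1) fixed degree
    (∀ (d : ℕ), 0 < d →
      ∀ (π : ∀ n, Fin d → Ω n → Equiv.Perm (Fin n)), (∀ n, IsIIDUniformPerm (π n) (P n)) →
      ∀ (Λ : ℕ → Ω' → ℕ),
        (∀ ℓ : ℕ, 1 ≤ ℓ → HasLaw (Λ ℓ) (poissonMeasure ((d : ℝ≥0) ^ ℓ / (ℓ : ℝ≥0))) P') →
        iIndepFun (fun ℓ : Set.Ici (1 : ℕ) => Λ ℓ) P' →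
      ∀ k : ℕ,
        TendstoInDistribution
          (fun (n : ℕ) (ω : Ω n) (j : Fin k) =>
            ((sumPermMatrix (π n) ω) ^ ((j : ℕ) + 1)).trace)
          atTop
          (fun (ω : Ω') (j : Fin k) =>
            ∑ ℓ ∈ Nat.divisors ((j : ℕ) + 1), (ℓ : ℝ) * (Λ ℓ ω : ℝ))
          P P') ∧
    -- (2) growing degree
    (∀ (d : ℕ → ℕ), Tendsto d atTop atTop →
      (fun n : ℕ => Real.log (d n : ℝ)) =o[atTop] (fun n : ℕ => Real.log (n : ℝ)) →
      ∀ (π : ∀ n, Fin (d n) → Ω n → Equiv.Perm (Fin n)), (∀ n, IsIIDUniformPerm (π n) (P n)) →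
      ∀ (N : ℕ → Ω' → ℝ),
        (∀ ℓ : ℕ, 1 ≤ ℓ → HasLaw (N ℓ) (gaussianReal 0 1) P') →
        iIndepFun (fun ℓ : Set.Ici (1 : ℕ) => N ℓ) P' →
      ∀ k : ℕ,
        TendstoInDistribution
          (fun (n : ℕ) (ω : Ω n) (j : Fin k) =>
            (((sumPermMatrix (π n) ω) ^ ((j : ℕ) + 1)).trace - (d n : ℝ) ^ ((j : ℕ) + 1)) /
              Real.sqrt ((d n : ℝ) ^ ((j : ℕ) + 1)))
          atTop
          (fun (ω : Ω') (j : Fin k) =>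
            Real.sqrt (((j : ℕ) + 1 : ℕ) : ℝ) * N ((j : ℕ) + 1) ω +
              if Even ((j : ℕ) + 1) then 1 else 0)
          P P') := by
  exact ⟨PermWalk.tendstoInDistribution_trace_of_const P P',
    PermWalk.tendstoInDistribution_trace_of_growing P P'⟩
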